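/- **Setting.** Consider a dynamic discrete-choice game with finitely many players $j\in J$, a common finite action set $A=\{0,1,\dots,|A|-1\}$ ($\tilde A=A\setminus\{0\}$) and a finite set $X$ of public states. Its elements are payoffs $\pi_j(\vec a,x)$, discount factors $\beta_j\in(0,1)$, transition probabilities $f(x'|\vec a,x)$, and conditional laws $F_\epsilon(\cdot|x)$ of the private shocks $\epsilon=(\epsilon_j(a))_{j\in J,a\in A}$, which have a density and full support, with $E[\epsilon_j|\epsilon_j\ge e]$ finite for every vector $e$. They depend on a parameter $(\alpha,g)\in\Theta_\alpha\times\Theta_g$, $\Theta_\alpha\subseteq\mathbb R^{d_\alpha}$, $\Theta_g\subseteq\mathbb R^{d_g}$, with true value $(\alpha^*,g^*)$. Beliefs are vectors $P=\{P_j(a|x):j\in J,a\in\tilde A,x\in X\}\in\mathbb R^{d_P}$, with $P_j(0|x)=1-\sum_{a\in\tilde A}P_j(a|x)$, and $d_\alpha\le d_P$. For $a\in A$ let $$\Psi_j(a,x;\alpha,g,P)=\int\prod_{k\in A}1[u_j(a,x)+\epsilon_j(a)\ge u_j(k,x)+\epsilon_j(k)]\,dF_\epsilon(\epsilon|x),$$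 $$u_j(a,x)=\sum_{\vec a:\,a_j=a}\ \prod_{s\ne j}P_s(a_s|x)\Big[\pi_j(\vec a,x)+\beta_j\sum_{x'}f(x'|\vec a,x)V_j(x';P)\Big],$$ where $V_j(\cdot;P)$ is the ex-ante value of player $j$ under the beliefs $P$, that is, the solution of $V_j=b_j^P+\beta_jF^PV_j$ with $F^P$ the state transition matrix induced by $P$ and $b_j^P(x)$ the expected period payoff, including $\sum_aP_j(a|x)E[\epsilon_j(a)\mid a\text{ is optimal}]$ computed at the action values that rationalize $P_j(\cdot|x)$. Let $\Psi(\alpha,g,P)\in\mathbb R^{d_P}$ stack $\Psi_j(a,x;\alpha,g,P)$ over $j\in J$, $a\in\tilde A$, $x\in X$, and let $\Psi_\lambda=\partial\Psi(\alpha^*,g^*,P^*)/\partial\lambda$ for $\lambda\in\{\alpha,g,P\}$. **Assumptions.** - (A1) The data $(\vec a_i,x_i,x_i')$, $i\le n$, are i.i.d. from a single pure-strategy Markov perfect equilibrium of the game at $(\alpha^*,g^*)$ with equilibrium choice probabilities $P^*$. - (A2) For $\alpha\in\Theta_\alpha$: $\Psi(\alpha,g^*,P^*)=P^*$ if and only if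 $\alpha=\alpha^*$. - (A3) (i) $\alpha^*$ is interior to $\Theta_\alpha$. Whenever $(\tilde g,\tilde P)=(g^*,P^*)+o_p(1)$: (ii) $\sup_{\alpha\in\Theta_\alpha}\|\Psi(\alpha,\tilde g,\tilde P)-\Psi(\alpha,g^*,P^*)\|=o_p(1)$, and (iii) $\inf_{\alpha\in\Theta_\alpha}\Psi_j(a,x;\alpha,\tilde g,\tilde P)>0$ for all $a\in A$, $j$, $x$, with probability approaching one. (iv) $\Psi$ is twice continuously differentiable in a neighborhood of $(\alpha^*,g^*,P^*)$. (v) $(I_{d_P}-\Psi_P,-\Psi_g)$ and $\Psi_\alpha$ have full rank. - (A4) With $\hat P$ the sample frequency estimator $\hat P_j(a|x)=\sum_{i\le n} 1[(a_{j,i},x_i)=(a,x)]/\sum_{i\le n} 1[x_i=x]$ and preliminary estimators $\hat P_0$, $\hat g$ (the latter in $\Theta_g$), $\sqrt n\,(\hat P-P^*,\hat P_0-P^*,\hat g-g^*)\overset d\to N(0,\Omega)$, $\Omega=\begin{pmatrix}\Omega_{PP}&\Omega_{P0}&\Omega_{Pg}\\\Omega_{P0}'&\Omega_{00}&\Omega_{0g}\\\Omega_{Pg}'&\Omega_{0g}'&\Omega_{gg}\end{pmatrix}$.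 - (Weights) For $1\le k\le K$, $\hat W_k$ is positive semidefinite and $\hat W_k\overset p\to W_k$, with $W_k$ positive definite and symmetric. - (Compactness) $\Theta_\alpha$ is compact and $\alpha\mapsto-(P^*-\Psi(\alpha,g^*,P^*))'W_k(P^*-\Psi(\alpha,g^*,P^*))$ is upper semicontinuous on $\Theta_\alpha$, for $1\le k\le K$. **Estimator.** For $k=1,\dots,K$, $\hat\alpha_k\in\arg\min_{\alpha\in\Theta_\alpha}(\hat P-\Psi(\alpha,\hat g,\hat P_{k-1}))'\hat W_k(\hat P-\Psi(\alpha,\hat g,\hat P_{k-1}))$ and $\hat P_k=\Psi(\hat\alpha_k,\hat g,\hat P_{k-1})$; the $K$-MD estimator is $\hat\alpha_{K\text{-}MD}=\hat\alpha_K$. **Theorem.** Fix $K\ge1$ and assume the above. Then $\hat\alpha_{K\text{-}MD}\overset p\to\alpha^*$ and $$\sqrt n(\hat\alpha_{K\text{-}MD}-\alpha^*)\overset d\to N(0,\Sigma),\qquad \Sigma=(\Psi_\alpha'W_K\Psi_\alpha)^{-1}\Psi_\alpha'W_K\,R\,\Omega\,R'\,W_K'\Psi_\alpha(\Psi_\alpha'W_K'\Psi_\alpha)^{-1},$$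 where $R=\big[\,I_{d_P}-\Psi_P\Phi_{K,P},\ -\Psi_P\Phi_{K,0},\ -(I_{d_P}+\Psi_P\Phi_{K,g})\Psi_g\,\big]$ and, with $H_k=\Psi_\alpha(\Psi_\alpha'W_k\Psi_\alpha)^{-1}\Psi_\alpha'W_k$, $$\Phi_{1,P}=0,\quad\Phi_{1,0}=I_{d_P},\quad\Phi_{1,g}=0_{d_P\times d_P},$$ $$\Phi_{k+1,P}=(I_{d_P}-H_k)\Psi_P\Phi_{k,P}+H_k,\quad\Phi_{k+1,0}=(I_{d_P}-H_k)\Psi_P\Phi_{k,0},\quad\Phi_{k+1,g}=(I_{d_P}-H_k)(I_{d_P}+\Psi_P\Phi_{k,g})\qquad(k\le K-1).$$ In particular $\Sigma$ is positive semidefinite. -/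

import Mathlib

open MeasureTheory ProbabilityTheory Filter Topology
open scoped Matrix

noncomputable section

namespace DynGame

/-! ### The dynamic discrete-choice game

There are `J` players, `m + 1` actions (`0` is the outside option, the others are `Fin.succ a` for
`a : Fin m`) and `X` publicly observed states. -/

/-- Action profiles. -/
abbrev Profile (J m : ℕ) := Fin J → Fin (m + 1)

/-- Private shocks of all players: `ε j a` is the shock of player `j` attached to action `a`. -/
abbrev Shock (J m : ℕ) := Fin J → Fin (m + 1) → ℝ

/-- Index set of a vector of conditional choice probabilities (CCPs): player, action other than
the outside option, state. -/
abbrev CCPIdx (J m X : ℕ) := Fin J × Fin m × Fin X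

/-- Vectors of CCPs (beliefs), `P (j, a, x) = P_j(a+1 | x)`. -/
abbrev CCP (J m X : ℕ) := EuclideanSpace ℝ (CCPIdx J m X)

/-- The elements of the game at one parameter value. -/
structure Game (J m X : ℕ) where
  /-- `payoff j b x`: deterministic part of the period payoff of player `j`. -/
  payoff : Fin J → Profile J m → Fin X → ℝ
  /-- Discount factors. -/
  discount : Fin J → ℝ
  /-- Law of the private shocks given the state. -/
  shockLaw : Fin X → Measure (Shock J m)
  /-- `trans x b x'`: probability of moving from state `x` to state `x'` under profile `b`. -/
  trans : Fin X → Profile J m → Fin X → ℝ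

variable {J m X : ℕ}

/-- The standing conditions on the elements of the game. -/
structure Game.IsAdmissible (G : Game J m X) : Prop where
  discount_pos : ∀ j, 0 < G.discount j
  discount_lt_one : ∀ j, G.discount j < 1
  trans_nonneg : ∀ x b x', 0 ≤ G.trans x b x'
  trans_sum : ∀ x b, ∑ x', G.trans x b x' = 1
  shock_prob : ∀ x, IsProbabilityMeasure (G.shockLaw x)
  /-- The shocks have a density. -/
  shock_density : ∀ x, G.shockLaw x ≪ volume
  /-- The shocks have full support. -/
  shock_support : ∀ x, (G.shockLaw x).IsOpenPosMeasure
  /-- `E[ε_j | ε_j ≥ e]` is finite for every vector `e`. -/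
  shock_moment : ∀ x j (e : Fin (m + 1) → ℝ) a,
    IntegrableOn (fun ε : Shock J m => ε j a) {ε | ∀ k, e k ≤ ε j k} (G.shockLaw x)

/-- The probability `P_j(a | x)` of every action, the outside option included. -/
def fullProb (P : CCP J m X) (j : Fin J) (x : Fin X) : Fin (m + 1) → ℝ :=
  Fin.cons (1 - ∑ a, P (j, a, x)) (fun a => P (j, a, x))

/-- Shocks for which action `a` is optimal for player `j` facing the action values `v`. -/
def choiceSet (j : Fin J) (v : Fin (m + 1) → ℝ) (a : Fin (m + 1)) : Set (Shock J m) :=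
  {ε | ∀ k, v k + ε j k ≤ v a + ε j a}

/-- Probability, under the law `F` of the shocks, that action `a` is optimal for player `j` facing
the action values `v`: `∫ ∏_k 1[v a + ε_j a ≥ v k + ε_j k] dF(ε)`. -/
def choiceProb (F : Measure (Shock J m)) (j : Fin J) (v : Fin (m + 1) → ℝ)
    (a : Fin (m + 1)) : ℝ :=
  ∫ ε, ∏ k, (if v a + ε j a ≥ v k + ε j k then (1 : ℝ) else 0) ∂F

/-- The inverse of the map from action values (normalized to `0` at the outside option) to choice
probabilities. For a law with a density and full support and for `p` in the interior of the simplex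
such a `v` exists and is unique. -/
def choiceProbInv (F : Measure (Shock J m)) (j : Fin J) (p : Fin (m + 1) → ℝ) :
    Fin (m + 1) → ℝ :=
  Classical.epsilon fun v => v 0 = 0 ∧ ∀ a, choiceProb F j v a = p a

/-- Expected shock of the chosen action, `∑_a p(a) E[ε_j(a) | a is optimal]`, for a player who
best-responds and whose choice probabilities are `p`. -/
def expectedShock (F : Measure (Shock J m)) (j : Fin J) (p : Fin (m + 1) → ℝ) : ℝ :=
  ∑ a, ∫ ε in choiceSet j (choiceProbInv F j p) a, ε j a ∂F

/-- Probability of an action profile under the beliefs `P`. -/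
def profileProb (P : CCP J m X) (x : Fin X) (b : Profile J m) : ℝ :=
  ∏ s, fullProb P s x (b s)

namespace Game

variable (G : Game J m X)

/-- State transition matrix induced by the beliefs `P`. -/
def transMatrix (P : CCP J m X) : Matrix (Fin X) (Fin X) ℝ :=
  Matrix.of fun x x' => ∑ b, profileProb P x b * G.trans x b x'

/-- Expected period payoff of player `j` under the beliefs `P`. -/
def flowPayoff (P : CCP J m X) (j : Fin J) (x : Fin X) : ℝ :=
  ∑ b, profileProb P x b * G.payoff j b x + expectedShock (G.shockLaw x) j (fullProb P j x)

/-- The ex-ante value function `V_j(· ; P)`, i.e. the expected discounted sum of payoffs under the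
beliefs `P` (the valuation operator): `V = (I - β F^P)⁻¹ (expected period payoff)`. -/
def exAnteValue (P : CCP J m X) (j : Fin J) : Fin X → ℝ :=
  (1 - G.discount j • G.transMatrix P)⁻¹ *ᵥ G.flowPayoff P j

/-- The value of action `a` for player `j` in state `x` (without the private shock), when the other
players act according to `P` and the continuation values are `V`. The sum runs over the profiles in
which player `j` chooses `a`. -/
def choiceValue (P : CCP J m X) (V : Fin X → ℝ) (j : Fin J) (a : Fin (m + 1)) (x : Fin X) : ℝ :=
  ∑ b ∈ Finset.univ.filter (fun b : Profile J m => b j = a),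
    (∏ s ∈ Finset.univ.erase j, fullProb P s x (b s)) *
      (G.payoff j b x + G.discount j * ∑ x', G.trans x b x' * V x')

/-- `Ψ_j(a, x; P)` for every action `a`: optimal choice probability given the beliefs `P`. -/
def psiFull (P : CCP J m X) (j : Fin J) (a : Fin (m + 1)) (x : Fin X) : ℝ :=
  choiceProb (G.shockLaw x) j (fun k => G.choiceValue P (G.exAnteValue P j) j k x) a

/-- The probability mapping `Ψ`, stacked over players, actions other than the outside option, and
states. -/
def psi (P : CCP J m X) : CCP J m X :=
  WithLp.toLp 2 fun i => G.psiFull P i.1 i.2.1.succ i.2.2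

/-- Markov perfect equilibrium in pure strategies `s j e x` (the action of player `j` with shock `e`
in state `x`), with common beliefs `P`. -/
structure IsMPE (P : CCP J m X) (s : Fin J → (Fin (m + 1) → ℝ) → Fin X → Fin (m + 1)) :
    Prop where
  measurable : ∀ j x, Measurable fun e => s j e x
  /-- The beliefs are the choice probabilities that the strategies generate. -/
  rational : ∀ j a x,
    (G.shockLaw x).real {ε | s j (ε j) x = a} = fullProb P j x a
  /-- Given the beliefs, the strategy of each player maximizes the expected discounted payoff: `V`
  is the value of following the strategy, and no one-period deviation is profitable. -/
  optimal : ∀ j, ∃ V : Fin X → ℝ,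
    (∀ x, Integrable (fun ε : Shock J m => ε j (s j (ε j) x)) (G.shockLaw x)) ∧
    (∀ x, V x = ∫ ε, (G.choiceValue P V j (s j (ε j) x) x + ε j (s j (ε j) x)) ∂G.shockLaw x) ∧
    ∀ x e a, G.choiceValue P V j a x + e a ≤ G.choiceValue P V j (s j e x) x + e (s j e x)

end Game

/-! ### The data -/

/-- One observation `(b, x, x')`: actions, current state, next state. -/
abbrev Obs (J m X : ℕ) := Profile J m × Fin X × Fin X

/-- `Z 0, Z 1, …` is an i.i.d. sample from a single MPE of the game `G`, with equilibrium CCPs `P`;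
`mx` is the marginal distribution of the current state. -/
def IsMPESample {Ω : Type*} [MeasurableSpace Ω] (μ : Measure Ω) (G : Game J m X)
    (P : CCP J m X) (Z : ℕ → Ω → Obs J m X) : Prop :=
  (∀ i, Measurable (Z i)) ∧ iIndepFun Z μ ∧
  ∃ s, G.IsMPE P s ∧ ∃ mx : Fin X → ℝ, ∀ i b x x',
    μ.real {ω | Z i ω = (b, x, x')} =
      mx x * (G.shockLaw x).real {ε | ∀ j, s j (ε j) x = b j} * G.trans x b x'

/-- The sample frequency estimator of the CCPs from the first `n` observations. -/
def freqCCP {Ω : Type*} (Z : ℕ → Ω → Obs J m X) (n : ℕ) (ω : Ω) : CCP J m X :=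
  WithLp.toLp 2 fun i =>
    ((∑ l ∈ Finset.range n,
        if (Z l ω).1 i.1 = i.2.1.succ ∧ (Z l ω).2.1 = i.2.2 then (1 : ℝ) else 0) / n) /
      ((∑ l ∈ Finset.range n, if (Z l ω).2.1 = i.2.2 then (1 : ℝ) else 0) / n)

/-- The event `p n` has probability approaching one. -/
def WPA1 {Ω : Type*} [MeasurableSpace Ω] (μ : Measure Ω) (p : ℕ → Ω → Prop) : Prop :=
  Tendsto (fun n => μ {ω | ¬ p n ω}) atTop (𝓝 0)

/-! ### Identification and regularity -/

section Parametric

variable {dα dg : ℕ}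

/-- `Ψ(α, g*, P*) = P*` if and only if `α = α*`. -/
def Identified (𝒢 : EuclideanSpace ℝ (Fin dα) → EuclideanSpace ℝ (Fin dg) → Game J m X)
    (Θα : Set (EuclideanSpace ℝ (Fin dα))) (αs : EuclideanSpace ℝ (Fin dα))
    (gs : EuclideanSpace ℝ (Fin dg)) (Ps : CCP J m X) : Prop :=
  ∀ α ∈ Θα, (𝒢 α gs).psi Ps = Ps ↔ α = αs

/-- The matrix of partial derivatives of `f` at `x`. -/
def jacobian {ι κ : Type*} [Fintype ι] [DecidableEq ι] [Fintype κ]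
    (f : EuclideanSpace ℝ ι → EuclideanSpace ℝ κ) (x : EuclideanSpace ℝ ι) : Matrix κ ι ℝ :=
  Matrix.of fun i j => fderiv ℝ f x (EuclideanSpace.single j 1) i

/-- `Ψ_α`, the Jacobian of `Ψ` in `α` at `(α*, g*, P*)`. -/
def psiA (𝒢 : EuclideanSpace ℝ (Fin dα) → EuclideanSpace ℝ (Fin dg) → Game J m X)
    (αs : EuclideanSpace ℝ (Fin dα)) (gs : EuclideanSpace ℝ (Fin dg)) (Ps : CCP J m X) :
    Matrix (CCPIdx J m X) (Fin dα) ℝ :=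
  jacobian (fun α => (𝒢 α gs).psi Ps) αs

/-- `Ψ_g`, the Jacobian of `Ψ` in `g` at `(α*, g*, P*)`. -/
def psiG (𝒢 : EuclideanSpace ℝ (Fin dα) → EuclideanSpace ℝ (Fin dg) → Game J m X)
    (αs : EuclideanSpace ℝ (Fin dα)) (gs : EuclideanSpace ℝ (Fin dg)) (Ps : CCP J m X) :
    Matrix (CCPIdx J m X) (Fin dg) ℝ :=
  jacobian (fun g => (𝒢 αs g).psi Ps) gs

/-- `Ψ_P`, the Jacobian of `Ψ` in `P` at `(α*, g*, P*)`. -/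
def psiP (𝒢 : EuclideanSpace ℝ (Fin dα) → EuclideanSpace ℝ (Fin dg) → Game J m X)
    (αs : EuclideanSpace ℝ (Fin dα)) (gs : EuclideanSpace ℝ (Fin dg)) (Ps : CCP J m X) :
    Matrix (CCPIdx J m X) (CCPIdx J m X) ℝ :=
  jacobian (fun P => (𝒢 αs gs).psi P) Ps

/-- A matrix of full rank. -/
def FullRank {ι κ : Type*} [Fintype ι] [Fintype κ] (M : Matrix ι κ ℝ) : Prop :=
  M.rank = min (Fintype.card ι) (Fintype.card κ)

/-- Sequences of random vectors `(g̃, P̃) = (g*, P*) + o_p(1)`, with `g̃` in the parameter space. -/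
structure ConsistentPair {Ω : Type*} [MeasurableSpace Ω] (μ : Measure Ω)
    (Θg : Set (EuclideanSpace ℝ (Fin dg))) (gs : EuclideanSpace ℝ (Fin dg)) (Ps : CCP J m X)
    (gt : ℕ → Ω → EuclideanSpace ℝ (Fin dg)) (Pt : ℕ → Ω → CCP J m X) : Prop where
  measurable_g : ∀ n, Measurable (gt n)
  measurable_P : ∀ n, Measurable (Pt n)
  mem : ∀ n ω, gt n ω ∈ Θg
  tendsto_g : TendstoInMeasure μ gt atTop (fun _ => gs)
  tendsto_P : TendstoInMeasure μ Pt atTop (fun _ => Ps)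

/-- The regularity conditions. -/
structure Regular {Ω : Type*} [MeasurableSpace Ω] (μ : Measure Ω)
    (𝒢 : EuclideanSpace ℝ (Fin dα) → EuclideanSpace ℝ (Fin dg) → Game J m X)
    (Θα : Set (EuclideanSpace ℝ (Fin dα))) (Θg : Set (EuclideanSpace ℝ (Fin dg)))
    (αs : EuclideanSpace ℝ (Fin dα)) (gs : EuclideanSpace ℝ (Fin dg)) (Ps : CCP J m X) :
    Prop where
  interior : αs ∈ interior Θα
  /-- `sup_α ‖Ψ(α, g̃, P̃) - Ψ(α, g*, P*)‖ = o_p(1)` whenever `(g̃, P̃) = (g*, P*) + o_p(1)`. -/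
  uniform : ∀ gt Pt, ConsistentPair μ Θg gs Ps gt Pt → ∀ δ > 0,
    WPA1 μ fun n ω => ∀ α ∈ Θα,
      ‖(𝒢 α (gt n ω)).psi (Pt n ω) - (𝒢 α gs).psi Ps‖ ≤ δ
  /-- `inf_α Ψ_{ajx}(α, g̃, P̃) > 0` with probability approaching one, for every action (the outside
  option included), player and state, whenever `(g̃, P̃) = (g*, P*) + o_p(1)`. -/
  positive : ∀ gt Pt, ConsistentPair μ Θg gs Ps gt Pt → ∀ j a x,
    WPA1 μ fun n ω => ∃ c > 0, ∀ α ∈ Θα, c ≤ (𝒢 α (gt n ω)).psiFull (Pt n ω) j a x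
  /-- `Ψ` is twice continuously differentiable in a neighborhood of `(α*, g*, P*)`. -/
  smooth : ContDiffAt ℝ 2
    (fun q : EuclideanSpace ℝ (Fin dα) × EuclideanSpace ℝ (Fin dg) × CCP J m X =>
      (𝒢 q.1 q.2.1).psi q.2.2) (αs, gs, Ps)
  fullRank_Pg : FullRank (Matrix.fromCols (1 - psiP 𝒢 αs gs Ps) (-psiG 𝒢 αs gs Ps))
  fullRank_α : FullRank (psiA 𝒢 αs gs Ps)

/-! ### Baseline convergence of the preliminary estimators -/

/-- Index set of the stacked vector `(P̂, P̂₀, ĝ)`. -/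
abbrev JointIdx (J m X dg : ℕ) := CCPIdx J m X ⊕ (CCPIdx J m X ⊕ Fin dg)

/-- The stacked vector `(P, P₀, g)`. -/
def stack (P P₀ : CCP J m X) (g : EuclideanSpace ℝ (Fin dg)) :
    EuclideanSpace ℝ (JointIdx J m X dg) :=
  WithLp.toLp 2 (Sum.elim P (Sum.elim P₀ g))

/-- `√n (P̂ - P*, P̂₀ - P*, ĝ - g*)` converges in distribution to `N(0, C)`; the blocks of `C` are
`Ω_PP, Ω_P0, Ω_Pg, …`. -/
def BaselineConvergence {Ω : Type*} [MeasurableSpace Ω] (μ : Measure Ω) [IsProbabilityMeasure μ]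
    (Z : ℕ → Ω → Obs J m X) (P₀ : ℕ → Ω → CCP J m X)
    (gh : ℕ → Ω → EuclideanSpace ℝ (Fin dg)) (Ps : CCP J m X) (gs : EuclideanSpace ℝ (Fin dg))
    (C : Matrix (JointIdx J m X dg) (JointIdx J m X dg) ℝ) : Prop :=
  C.PosSemidef ∧
  TendstoInDistribution
    (fun (n : ℕ) ω => √(n : ℝ) • stack (freqCCP Z n ω - Ps) (P₀ n ω - Ps) (gh n ω - gs))
    atTop id (fun _ => μ) (multivariateGaussian 0 C)

/-! ### The estimator -/

/-- The (negative) minimum distance criterion `-(p - q)' W (p - q)`. -/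
def mdCriterion (W : Matrix (CCPIdx J m X) (CCPIdx J m X) ℝ) (p q : CCP J m X) : ℝ :=
  -((p - q).ofLp ⬝ᵥ (W *ᵥ (p - q).ofLp))

/-- The iterated CCP estimators: `P̂₀` is given and `P̂_k = Ψ(α̂_k, ĝ, P̂_{k-1})`. -/
def iterCCP (𝒢 : EuclideanSpace ℝ (Fin dα) → EuclideanSpace ℝ (Fin dg) → Game J m X)
    (αh : ℕ → EuclideanSpace ℝ (Fin dα)) (g : EuclideanSpace ℝ (Fin dg)) (P₀ : CCP J m X) :
    ℕ → CCP J m X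
  | 0 => P₀
  | k + 1 => (𝒢 (αh (k + 1)) g).psi (iterCCP 𝒢 αh g P₀ k)

/-- `αh k n` is the `k`-MD estimator for sample size `n`, for `k = 1, …, K`: with probability
approaching one it maximizes the `k`-th criterion over `Θα`. -/
def IsKMD {Ω : Type*} [MeasurableSpace Ω] (μ : Measure Ω)
    (𝒢 : EuclideanSpace ℝ (Fin dα) → EuclideanSpace ℝ (Fin dg) → Game J m X)
    (Θα : Set (EuclideanSpace ℝ (Fin dα))) (Z : ℕ → Ω → Obs J m X)
    (P₀ : ℕ → Ω → CCP J m X) (gh : ℕ → Ω → EuclideanSpace ℝ (Fin dg))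
    (Wh : ℕ → ℕ → Ω → Matrix (CCPIdx J m X) (CCPIdx J m X) ℝ) (K : ℕ)
    (αh : ℕ → ℕ → Ω → EuclideanSpace ℝ (Fin dα)) : Prop :=
  ∀ k, 1 ≤ k → k ≤ K →
    (∀ n, AEMeasurable (αh k n) μ) ∧
    WPA1 μ fun n ω => αh k n ω ∈ Θα ∧
      IsMaxOn (fun α => mdCriterion (Wh k n ω) (freqCCP Z n ω)
        ((𝒢 α (gh n ω)).psi (iterCCP 𝒢 (fun l => αh l n ω) (gh n ω) (P₀ n ω) (k - 1))))
        Θα (αh k n ω)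

/-- Positive semidefinite weights `Ŵ_k` converging in probability to positive definite symmetric
`W_k`, for `k = 1, …, K`. (`Matrix.PosDef` includes symmetry.) -/
def WeightConvergence {Ω : Type*} [MeasurableSpace Ω] (μ : Measure Ω)
    (Wh : ℕ → ℕ → Ω → Matrix (CCPIdx J m X) (CCPIdx J m X) ℝ)
    (W : ℕ → Matrix (CCPIdx J m X) (CCPIdx J m X) ℝ) (K : ℕ) : Prop :=
  ∀ k, 1 ≤ k → k ≤ K →
    (∀ n ω v, 0 ≤ v ⬝ᵥ (Wh k n ω *ᵥ v)) ∧
    (∀ i j, TendstoInMeasure μ (fun n ω => Wh k n ω i j) atTop (fun _ => W k i j)) ∧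
    (W k).PosDef

end Parametric

/-! ### The asymptotic variance -/

section Variance

variable {ι κ γ : Type*} [Fintype ι] [DecidableEq ι] [Fintype κ] [DecidableEq κ]
  [Fintype γ] [DecidableEq γ]

/-- `Ψ_α (Ψ_α' W Ψ_α)⁻¹ Ψ_α' W`. -/
def wProj (A : Matrix ι κ ℝ) (W : Matrix ι ι ℝ) : Matrix ι ι ℝ :=
  A * (Aᵀ * W * A)⁻¹ * Aᵀ * W

/-- `Φ_{k,P}`; the sequence starts at `k = 1`, the value at `0` is not used. Here `A = Ψ_α` and
`B = Ψ_P`. -/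
def phiP (A : Matrix ι κ ℝ) (B : Matrix ι ι ℝ) (W : ℕ → Matrix ι ι ℝ) : ℕ → Matrix ι ι ℝ
  | 0 => 0
  | 1 => 0
  | k + 2 => (1 - wProj A (W (k + 1))) * B * phiP A B W (k + 1) + wProj A (W (k + 1))

/-- `Φ_{k,0}`; the sequence starts at `k = 1`, the value at `0` is not used. -/
def phi0 (A : Matrix ι κ ℝ) (B : Matrix ι ι ℝ) (W : ℕ → Matrix ι ι ℝ) : ℕ → Matrix ι ι ℝ
  | 0 => 0
  | 1 => 1
  | k + 2 => (1 - wProj A (W (k + 1))) * B * phi0 A B W (k + 1)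

/-- `Φ_{k,g}`; the sequence starts at `k = 1`, the value at `0` is not used. -/
def phiG (A : Matrix ι κ ℝ) (B : Matrix ι ι ℝ) (W : ℕ → Matrix ι ι ℝ) : ℕ → Matrix ι ι ℝ
  | 0 => 0
  | 1 => 0
  | k + 2 => (1 - wProj A (W (k + 1))) * (1 + B * phiG A B W (k + 1))

/-- The block matrix `[I - Ψ_P Φ_{K,P}, -Ψ_P Φ_{K,0}, -(I + Ψ_P Φ_{K,g}) Ψ_g]`, with `A = Ψ_α`,
`B = Ψ_P` and `D = Ψ_g`. -/
def sandwichRow (A : Matrix ι κ ℝ) (B : Matrix ι ι ℝ) (D : Matrix ι γ ℝ)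
    (W : ℕ → Matrix ι ι ℝ) (K : ℕ) : Matrix ι (ι ⊕ (ι ⊕ γ)) ℝ :=
  Matrix.fromCols (1 - B * phiP A B W K)
    (Matrix.fromCols (-(B * phi0 A B W K)) (-((1 + B * phiG A B W K) * D)))

/-- The asymptotic variance of the `K`-MD estimator. -/
def sigmaKMD (A : Matrix ι κ ℝ) (B : Matrix ι ι ℝ) (D : Matrix ι γ ℝ)
    (C : Matrix (ι ⊕ (ι ⊕ γ)) (ι ⊕ (ι ⊕ γ)) ℝ) (W : ℕ → Matrix ι ι ℝ) (K : ℕ) :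
    Matrix κ κ ℝ :=
  ((Aᵀ * W K * A)⁻¹ * Aᵀ * W K) *
    (sandwichRow A B D W K * C * (sandwichRow A B D W K)ᵀ) *
    ((W K)ᵀ * A * (Aᵀ * (W K)ᵀ * A)⁻¹)

end Variance

end DynGame

end

open DynGame

/-!
# Asymptotic normality of the iterated minimum distance estimator

The events of probability approaching one form a filter `inProb μ` on `ℕ × Ω`. Convergence in
probability is convergence along this filter and `o_p` is the Landau symbol along it, so
everything except the final distributional limit is deterministic analysis along a filter.

*Consistency.* Along an ultrafilter the estimator converges, by compactness, and the fitted values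
converge too, being bounded probabilities. Comparing the criterion at the estimator and at the
truth shows that the limit criterion is nonnegative at the limit point, and identification makes
that point the truth (`tendsto_of_isMaxOn_mdCriterion`). Continuity of `Ψ` carries consistency from
one iteration to the next (`tendsto_iterated`). The required uniform convergence of
`Ψ(·, g̃, P̃)` follows by applying the stochastic assumption to nonrandom sequences
(`Regular.eventually_uniform`), which also makes measurability of the iterated beliefs irrelevant.

*Linearization.* A consistent maximizer is eventually interior, so it satisfies a first-order
condition. Expanding `Ψ` there and inverting `Ψ_α' W Ψ_α` expresses the estimation error, up to a
remainder of smaller order, linearly in the errors of `P̂`, `ĝ` and the current beliefs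
(`expansion_of_isMaxOn`); a nonsymmetric weight enters only through its symmetrization, whose
limit is `W`. The belief errors obey the same kind of expansion, and the resulting linear recursion
is the one that defines `Φ_{k,P}`, `Φ_{k,0}` and `Φ_{k,g}` (`expansion_of_iterated`).

*Limit law.* The scaled first-stage errors are tight, so the remainder vanishes in probability
after scaling (`tendsto_zero_of_isLittleO_inProb`). The leading term is a matrix applied to an
asymptotically Gaussian vector, and the image of `N(0, Ω)` under a matrix `L` is `N(0, L Ω L')`
(`multivariateGaussian_map_mulVecCLM`).
-/

namespace DynGame

open Asymptotics

/-! ### Matrices acting on Euclidean spaces -/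

section LinearAlgebra

variable {ι κ γ : Type*} [Fintype ι] [Fintype κ] [DecidableEq κ] [Fintype γ] [DecidableEq γ]

/-- The continuous linear map `v ↦ M v` between Euclidean spaces. -/
noncomputable def mulVecCLM (M : Matrix ι κ ℝ) : EuclideanSpace ℝ κ →L[ℝ] EuclideanSpace ℝ ι :=
  LinearMap.toContinuousLinearMap (Matrix.toLpLin 2 2 M)

@[simp] lemma ofLp_mulVecCLM (M : Matrix ι κ ℝ) (v : EuclideanSpace ℝ κ) :
    (mulVecCLM M v).ofLp = M *ᵥ v.ofLp := rfl

lemma mulVecCLM_mul (M : Matrix ι κ ℝ) (N : Matrix κ γ ℝ) (v : EuclideanSpace ℝ γ) :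
    mulVecCLM (M * N) v = mulVecCLM M (mulVecCLM N v) := by
  apply WithLp.ofLp_injective 2
  simp [Matrix.mulVec_mulVec]

lemma continuous_mulVecCLM :
    Continuous (mulVecCLM : Matrix ι κ ℝ → EuclideanSpace ℝ κ →L[ℝ] EuclideanSpace ℝ ι) :=
  LinearMap.continuous_of_finiteDimensional
    ((Matrix.toLpLin 2 2).trans LinearMap.toContinuousLinearMap : Matrix ι κ ℝ ≃ₗ[ℝ] _).toLinearMap

lemma mulVecCLM_add (M N : Matrix ι κ ℝ) (v : EuclideanSpace ℝ κ) :
    mulVecCLM (M + N) v = mulVecCLM M v + mulVecCLM N v := by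
  apply WithLp.ofLp_injective 2
  simp [Matrix.add_mulVec]

lemma mulVecCLM_sub (M N : Matrix ι κ ℝ) (v : EuclideanSpace ℝ κ) :
    mulVecCLM (M - N) v = mulVecCLM M v - mulVecCLM N v := by
  apply WithLp.ofLp_injective 2
  simp [Matrix.sub_mulVec]

@[simp] lemma mulVecCLM_neg (M : Matrix ι κ ℝ) (v : EuclideanSpace ℝ κ) :
    mulVecCLM (-M) v = -mulVecCLM M v := by
  apply WithLp.ofLp_injective 2
  simp [Matrix.neg_mulVec]

@[simp] lemma mulVecCLM_one (v : EuclideanSpace ℝ κ) : mulVecCLM (1 : Matrix κ κ ℝ) v = v := by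
  apply WithLp.ofLp_injective 2
  simp

@[simp] lemma mulVecCLM_zero (v : EuclideanSpace ℝ κ) :
    mulVecCLM (0 : Matrix ι κ ℝ) v = 0 := by
  apply WithLp.ofLp_injective 2
  simp

lemma mulVecCLM_jacobian (f : EuclideanSpace ℝ κ → EuclideanSpace ℝ ι) (x v : EuclideanSpace ℝ κ) :
    mulVecCLM (jacobian f x) v = fderiv ℝ f x v := by
  have h : (mulVecCLM (jacobian f x)).toLinearMap = (fderiv ℝ f x).toLinearMap := by
    refine (EuclideanSpace.basisFun κ ℝ).toBasis.ext fun i => ?_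
    ext j
    simp [jacobian]
  exact congrArg (fun L => L v) h

lemma inner_mulVecCLM [DecidableEq ι] (S : Matrix ι κ ℝ) (x : EuclideanSpace ℝ κ)
    (y : EuclideanSpace ℝ ι) :
    inner ℝ (mulVecCLM S x) y = inner ℝ x (mulVecCLM Sᵀ y) := by
  simp only [EuclideanSpace.inner_eq_star_dotProduct, ofLp_mulVecCLM, star_trivial]
  rw [Matrix.dotProduct_mulVec, Matrix.mulVec_transpose]

lemma adjoint_mulVecCLM [DecidableEq ι] (S : Matrix ι κ ℝ) :
    ContinuousLinearMap.adjoint (mulVecCLM S) = mulVecCLM Sᵀ := by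
  refine ((ContinuousLinearMap.eq_adjoint_iff _ _).2 fun x y => ?_).symm
  rw [inner_mulVecCLM, Matrix.transpose_transpose]

/-- The image of a centred Gaussian law under a matrix `M` is the centred Gaussian law whose
covariance matrix is `M S M'`. -/
lemma multivariateGaussian_map_mulVecCLM [DecidableEq ι] {S : Matrix κ κ ℝ} (hS : S.PosSemidef)
    (M : Matrix ι κ ℝ) :
    (multivariateGaussian 0 S).map (mulVecCLM M) = multivariateGaussian 0 (M * S * Mᵀ) := by
  have hS' : (M * S * Mᵀ).PosSemidef := by
    simpa using hS.mul_mul_conjTranspose_same M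
  apply IsGaussian.ext
  · simp only [id_eq, integral_id_multivariateGaussian]
    rw [ContinuousLinearMap.integral_id_map, integral_id_multivariateGaussian, map_zero]
    exact IsGaussian.integrable_id
  · ext u v
    rw [covarianceBilin_map IsGaussian.memLp_two_id, covarianceBilin_multivariateGaussian hS,
      covarianceBilin_multivariateGaussian hS', adjoint_mulVecCLM]
    simp only [ofLp_mulVecCLM, ← Matrix.mulVec_mulVec]
    rw [Matrix.dotProduct_mulVec u.ofLp M, Matrix.mulVec_transpose M u.ofLp]

omit [DecidableEq κ] in
lemma mulVec_injective_of_fullRank {A : Matrix ι κ ℝ} (hA : FullRank A)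
    (hcard : Fintype.card κ ≤ Fintype.card ι) : Function.Injective A.mulVec := by
  rw [Matrix.mulVec_injective_iff, linearIndependent_iff_card_eq_finrank_span, Set.finrank,
    ← Matrix.rank_eq_finrank_span_cols, hA, min_eq_right hcard]

/-- The Gram matrix `A' W A` in a positive definite weight is invertible. -/
lemma isUnit_det_weightedGram {A : Matrix ι κ ℝ} (hA : Function.Injective A.mulVec)
    {W : Matrix ι ι ℝ} (hW : W.PosDef) : IsUnit (Aᵀ * W * A).det := by
  have h : (Aᵀ * W * A).PosDef := by
    simpa using hW.conjTranspose_mul_mul_same hA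
  exact h.det_pos.ne'.isUnit

end LinearAlgebra

/-! ### Consistency of minimum distance estimators along a filter -/

section Consistency

variable {J m X : ℕ} {T : Type*} {l : Filter T}

lemma mdCriterion_eq_inner (W : Matrix (CCPIdx J m X) (CCPIdx J m X) ℝ) (p q : CCP J m X) :
    mdCriterion W p q = -inner ℝ (p - q) (mulVecCLM W (p - q)) := by
  rw [mdCriterion, EuclideanSpace.inner_eq_star_dotProduct, ofLp_mulVecCLM, star_trivial,
    dotProduct_comm]

lemma continuous_mdCriterion :
    Continuous fun w : Matrix (CCPIdx J m X) (CCPIdx J m X) ℝ × CCP J m X × CCP J m X =>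
      mdCriterion w.1 w.2.1 w.2.2 := by
  have h : Continuous fun w : Matrix (CCPIdx J m X) (CCPIdx J m X) ℝ × CCP J m X × CCP J m X =>
      mulVecCLM w.1 := continuous_mulVecCLM.comp continuous_fst
  simp only [mdCriterion_eq_inner]
  fun_prop

lemma eq_of_mdCriterion_nonneg {W : Matrix (CCPIdx J m X) (CCPIdx J m X) ℝ} (hW : W.PosDef)
    {p q : CCP J m X} (h : 0 ≤ mdCriterion W p q) : q = p := by
  by_contra hne
  have h0 : (p - q).ofLp ≠ 0 := fun h0 =>
    hne (sub_eq_zero.1 (WithLp.ofLp_injective 2 h0 : p - q = 0)).symm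
  have := hW.dotProduct_mulVec_pos h0
  rw [star_trivial] at this
  unfold mdCriterion at h
  linarith

/-- Consistency of the minimum distance estimator. Along any ultrafilter the maximizer `a`
converges to some point of the compact set `Θ` and the fitted values `q t (a t)` converge as well;
comparing with the value at `a₀` shows that the limit criterion is nonnegative at the limit of `a`,
by upper semicontinuity, and identification forces that limit to be `a₀`. -/
lemma tendsto_of_isMaxOn_mdCriterion {E : Type*} [TopologicalSpace E] {Θ : Set E}
    (hΘ : IsCompact Θ) {a₀ : E} (ha₀ : a₀ ∈ Θ) {W : Matrix (CCPIdx J m X) (CCPIdx J m X) ℝ}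
    (hW : W.PosDef) {q₀ : E → CCP J m X} {p₀ : CCP J m X} (hid : ∀ a ∈ Θ, q₀ a = p₀ ↔ a = a₀)
    (husc : UpperSemicontinuousOn (fun a => mdCriterion W p₀ (q₀ a)) Θ)
    {c : ℝ} (hc : ∀ a ∈ Θ, ‖q₀ a‖ ≤ c)
    {Wh : T → Matrix (CCPIdx J m X) (CCPIdx J m X) ℝ} (hWh : Tendsto Wh l (𝓝 W))
    {p : T → CCP J m X} (hp : Tendsto p l (𝓝 p₀)) {q : T → E → CCP J m X}
    (hq : ∀ δ > 0, ∀ᶠ t in l, ∀ a ∈ Θ, ‖q t a - q₀ a‖ ≤ δ) {a : T → E}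
    (ha : ∀ᶠ t in l, a t ∈ Θ ∧ IsMaxOn (fun b => mdCriterion (Wh t) (p t) (q t b)) Θ (a t)) :
    Tendsto a l (𝓝 a₀) := by
  rw [tendsto_iff_ultrafilter]
  intro u hu
  have hmem : ∀ᶠ t in (u : Filter T), a t ∈ Θ := (ha.mono fun t h => h.1).filter_mono hu
  obtain ⟨b, hb, hab⟩ := hΘ.ultrafilter_le_nhds (u.map a) (le_principal_iff.2 hmem)
  have hab : Tendsto a u (𝓝 b) := hab
  obtain ⟨r, -, hr⟩ := (isCompact_closedBall (0 : CCP J m X) c).ultrafilter_le_nhds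
    (u.map fun t => q₀ (a t)) (le_principal_iff.2 (hmem.mono fun t ht => by
      simpa using hc _ ht))
  have hr : Tendsto (fun t => q₀ (a t)) u (𝓝 r) := hr
  have hdiff : Tendsto (fun t => q t (a t) - q₀ (a t)) u (𝓝 0) := by
    rw [Metric.tendsto_nhds]
    intro ε hε
    filter_upwards [(hq (ε / 2) (half_pos hε)).filter_mono hu, hmem] with t h1 h2
    rw [dist_zero_right]
    exact (h1 _ h2).trans_lt (half_lt_self hε)
  have hdiff₀ : Tendsto (fun t => q t a₀ - q₀ a₀) u (𝓝 0) := by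
    rw [Metric.tendsto_nhds]
    intro ε hε
    filter_upwards [(hq (ε / 2) (half_pos hε)).filter_mono hu] with t h1
    rw [dist_zero_right]
    exact (h1 _ ha₀).trans_lt (half_lt_self hε)
  have hqr : Tendsto (fun t => q t (a t)) u (𝓝 r) := by simpa using hdiff.add hr
  have hqp : Tendsto (fun t => q t a₀) u (𝓝 p₀) := by
    simpa [(hid a₀ ha₀).2 rfl] using hdiff₀.add_const (q₀ a₀)
  have hWu := hWh.mono_left hu
  have hpu := hp.mono_left hu
  have hlim : ∀ {f : T → CCP J m X} {s : CCP J m X}, Tendsto f u (𝓝 s) →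
      Tendsto (fun t => mdCriterion (Wh t) (p t) (f t)) u (𝓝 (mdCriterion W p₀ s)) :=
    fun {f s} hf => by
      have h : Tendsto (fun t => (Wh t, p t, f t)) u (𝓝 (W, p₀, s)) :=
        hWu.prodMk_nhds (hpu.prodMk_nhds hf)
      have hcomp := (continuous_mdCriterion.tendsto (W, p₀, s)).comp h
      exact hcomp
  have hnonneg : 0 ≤ mdCriterion W p₀ r := by
    have h0 : mdCriterion W p₀ p₀ = 0 := by simp [mdCriterion]
    rw [← h0]
    exact le_of_tendsto_of_tendsto (hlim hqp) (hlim hqr)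
      ((ha.filter_mono hu).mono fun t h => h.2 ha₀)
  have hlim₀ : Tendsto (fun t => mdCriterion W p₀ (q₀ (a t))) u (𝓝 (mdCriterion W p₀ r)) := by
    have h : Tendsto (fun t => (W, p₀, q₀ (a t))) u (𝓝 (W, p₀, r)) :=
      tendsto_const_nhds.prodMk_nhds (tendsto_const_nhds.prodMk_nhds hr)
    have hcomp := (continuous_mdCriterion.tendsto (W, p₀, r)).comp h
    exact hcomp
  have hb0 : 0 ≤ mdCriterion W p₀ (q₀ b) := by
    by_contra! hneg
    have h1 : ∀ᶠ t in (u : Filter T),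
        mdCriterion W p₀ (q₀ (a t)) < mdCriterion W p₀ (q₀ b) / 2 :=
      (tendsto_nhdsWithin_iff.2 ⟨hab, hmem⟩).eventually (husc b hb _ (by linarith))
    have h2 := le_of_tendsto hlim₀ (h1.mono fun t h => h.le)
    linarith
  rw [← (hid b hb).1 (eq_of_mdCriterion_nonneg hW hb0)]
  exact hab

end Consistency

/-! ### Linearization of the estimator and of the updated beliefs -/

section Linearization

variable {J m X dα dg : ℕ} {T : Type*} {l : Filter T}
  {ψ : EuclideanSpace ℝ (Fin dα) → EuclideanSpace ℝ (Fin dg) → CCP J m X → CCP J m X}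
  {α₀ : EuclideanSpace ℝ (Fin dα)} {g₀ : EuclideanSpace ℝ (Fin dg)} {P₀ : CCP J m X}

/-- The derivative of `ψ` in all its arguments is the sum of the three partial Jacobians. -/
lemma fderiv_apply_eq_partials
    (hψ : DifferentiableAt ℝ (fun q : EuclideanSpace ℝ (Fin dα) × EuclideanSpace ℝ (Fin dg) ×
      CCP J m X => ψ q.1 q.2.1 q.2.2) (α₀, g₀, P₀))
    (a : EuclideanSpace ℝ (Fin dα)) (d : EuclideanSpace ℝ (Fin dg)) (b : CCP J m X) :
    fderiv ℝ (fun q : EuclideanSpace ℝ (Fin dα) × EuclideanSpace ℝ (Fin dg) ×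
      CCP J m X => ψ q.1 q.2.1 q.2.2) (α₀, g₀, P₀) (a, d, b) =
      mulVecCLM (jacobian (fun α => ψ α g₀ P₀) α₀) a +
      mulVecCLM (jacobian (fun g => ψ α₀ g P₀) g₀) d +
      mulVecCLM (jacobian (fun P => ψ α₀ g₀ P) P₀) b := by
  set F := fun q : EuclideanSpace ℝ (Fin dα) × EuclideanSpace ℝ (Fin dg) ×
      CCP J m X => ψ q.1 q.2.1 q.2.2 with hF
  have h1 : HasFDerivAt (fun α => ψ α g₀ P₀) _ α₀ :=
    HasFDerivAt.comp (g := F) (f := fun α => (α, g₀, P₀)) α₀ hψ.hasFDerivAt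
      ((hasFDerivAt_id α₀).prodMk (hasFDerivAt_const (g₀, P₀) α₀))
  have h2 : HasFDerivAt (fun g => ψ α₀ g P₀) _ g₀ :=
    HasFDerivAt.comp (g := F) (f := fun g => (α₀, g, P₀)) g₀ hψ.hasFDerivAt
      ((hasFDerivAt_const α₀ g₀).prodMk
      ((hasFDerivAt_id g₀).prodMk (hasFDerivAt_const P₀ g₀)))
  have h3 : HasFDerivAt (fun P => ψ α₀ g₀ P) _ P₀ :=
    HasFDerivAt.comp (g := F) (f := fun P => (α₀, g₀, P)) P₀ hψ.hasFDerivAt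
      ((hasFDerivAt_const α₀ P₀).prodMk
      ((hasFDerivAt_const g₀ P₀).prodMk (hasFDerivAt_id P₀)))
  simp only [mulVecCLM_jacobian, h1.fderiv, h2.fderiv, h3.fderiv]
  simp only [ContinuousLinearMap.comp_apply, ← map_add]
  simp

/-- First-order condition: at an interior maximizer the residual is orthogonal, in the symmetrized
weight, to the derivative of the fitted values. -/
lemma firstOrder_mdCriterion {W : Matrix (CCPIdx J m X) (CCPIdx J m X) ℝ} {p : CCP J m X}
    {f : EuclideanSpace ℝ (Fin dα) → CCP J m X} {a : EuclideanSpace ℝ (Fin dα)}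
    (hf : DifferentiableAt ℝ f a) (hmax : IsLocalMax (fun b => mdCriterion W p (f b)) a) :
    mulVecCLM ((jacobian f a)ᵀ * (W + Wᵀ)) (p - f a) = 0 := by
  have hr := hf.hasFDerivAt.const_sub p
  have hd := (hr.inner ℝ ((mulVecCLM W).hasFDerivAt.comp a hr)).neg
  have hmax' : IsLocalMax (fun b => -inner ℝ (p - f b) ((mulVecCLM W ∘ fun b => p - f b) b)) a := by
    simpa only [mdCriterion_eq_inner, Function.comp_apply] using hmax
  have h0 := hmax'.hasFDerivAt_eq_zero hd
  refine ext_inner_left ℝ fun v => ?_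
  have h1 := congrArg (fun L => L v) h0
  simp only [neg_apply, ContinuousLinearMap.comp_apply,
    ContinuousLinearMap.prod_apply, fderivInnerCLM_apply, Function.comp_apply,
    zero_apply, map_neg, inner_neg_left, inner_neg_right] at h1
  rw [inner_zero_right, mulVecCLM_mul, ← inner_mulVecCLM, mulVecCLM_jacobian, mulVecCLM_add,
    inner_add_right, ← inner_mulVecCLM, real_inner_comm (p - f a) (mulVecCLM W _)]
  linarith

/-- If `a` equals a quantity of order `τ` up to an error small compared with `τ` and `a` itself,
then `a` is of order `τ`. -/
lemma isBigO_of_sub_isLittleO_add {E : Type*} [SeminormedAddCommGroup E] {a u : T → E} {τ : T → ℝ}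
    (hu : u =O[l] τ) (h : (fun t => a t - u t) =o[l] fun t => ‖τ t‖ + ‖a t‖) : a =O[l] τ := by
  obtain ⟨c, hc⟩ := hu.bound
  refine IsBigO.of_bound (2 * c + 1) ?_
  filter_upwards [hc, h.bound (half_pos one_pos)] with t h1 h2
  have h3 : ‖a t‖ ≤ ‖a t - u t‖ + ‖u t‖ := by simpa using norm_add_le (a t - u t) (u t)
  have h4 : ‖(‖τ t‖ + ‖a t‖)‖ = ‖τ t‖ + ‖a t‖ := Real.norm_of_nonneg (by positivity)
  rw [h4] at h2
  linarith

/-- The linear expansion of the map `ψ` along arguments converging to `(α₀, g₀, P₀)`. -/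
lemma expansion_of_map
    (hψ : DifferentiableAt ℝ (fun q : EuclideanSpace ℝ (Fin dα) × EuclideanSpace ℝ (Fin dg) ×
      CCP J m X => ψ q.1 q.2.1 q.2.2) (α₀, g₀, P₀))
    {a : T → EuclideanSpace ℝ (Fin dα)} {g : T → EuclideanSpace ℝ (Fin dg)} {P : T → CCP J m X}
    (ha : Tendsto a l (𝓝 α₀)) (hg : Tendsto g l (𝓝 g₀)) (hP : Tendsto P l (𝓝 P₀)) {σ : T → ℝ}
    (haσ : (fun t => a t - α₀) =O[l] σ) (hgσ : (fun t => g t - g₀) =O[l] σ)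
    (hPσ : (fun t => P t - P₀) =O[l] σ) :
    (fun t => ψ (a t) (g t) (P t) - ψ α₀ g₀ P₀ -
      (mulVecCLM (jacobian (fun α => ψ α g₀ P₀) α₀) (a t - α₀) +
      mulVecCLM (jacobian (fun g => ψ α₀ g P₀) g₀) (g t - g₀) +
      mulVecCLM (jacobian (fun P => ψ α₀ g₀ P) P₀) (P t - P₀))) =o[l] σ := by
  have h := (hψ.hasFDerivAt.isLittleO.comp_tendsto
    (ha.prodMk_nhds (hg.prodMk_nhds hP))).trans_isBigO
    (g := fun t => (a t, g t, P t) - (α₀, g₀, P₀)) (k := σ) (haσ.prod_left (hgσ.prod_left hPσ))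
  refine h.congr_left fun t => ?_
  rw [← fderiv_apply_eq_partials hψ]
  rfl

/-- Linear expansion of a consistent minimum distance estimator. The first-order condition says
that `G' (Ŵ + Ŵ')` annihilates the residual, where `G` is the Jacobian at the estimator; this matrix
converges to `2 A' W`, so `A' W` annihilates the residual up to a smaller order. -/
lemma expansion_of_isMaxOn
    (hψ : ContDiffAt ℝ 2 (fun q : EuclideanSpace ℝ (Fin dα) × EuclideanSpace ℝ (Fin dg) ×
      CCP J m X => ψ q.1 q.2.1 q.2.2) (α₀, g₀, P₀)) (hfix : ψ α₀ g₀ P₀ = P₀)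
    {Θ : Set (EuclideanSpace ℝ (Fin dα))} (hΘ : α₀ ∈ interior Θ)
    {A : Matrix (CCPIdx J m X) (Fin dα) ℝ} {D : Matrix (CCPIdx J m X) (Fin dg) ℝ}
    {B W : Matrix (CCPIdx J m X) (CCPIdx J m X) ℝ}
    (hA : A = jacobian (fun α => ψ α g₀ P₀) α₀) (hD : D = jacobian (fun g => ψ α₀ g P₀) g₀)
    (hB : B = jacobian (fun P => ψ α₀ g₀ P) P₀) (hW : Wᵀ = W) (hdet : IsUnit (Aᵀ * W * A).det)
    {a : T → EuclideanSpace ℝ (Fin dα)} {g : T → EuclideanSpace ℝ (Fin dg)} {P p : T → CCP J m X}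
    {Wh : T → Matrix (CCPIdx J m X) (CCPIdx J m X) ℝ}
    (ha : Tendsto a l (𝓝 α₀)) (hg : Tendsto g l (𝓝 g₀)) (hP : Tendsto P l (𝓝 P₀))
    (hWh : Tendsto Wh l (𝓝 W)) {τ : T → ℝ} (hgτ : (fun t => g t - g₀) =O[l] τ)
    (hPτ : (fun t => P t - P₀) =O[l] τ) (hpτ : (fun t => p t - P₀) =O[l] τ)
    (hmax : ∀ᶠ t in l, IsMaxOn (fun b => mdCriterion (Wh t) (p t) (ψ b (g t) (P t))) Θ (a t)) :
    (fun t => a t - α₀) =O[l] τ ∧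
    (fun t => a t - α₀ - mulVecCLM ((Aᵀ * W * A)⁻¹ * Aᵀ * W)
      ((p t - P₀) - mulVecCLM D (g t - g₀) - mulVecCLM B (P t - P₀))) =o[l] τ := by
  set F := fun q : EuclideanSpace ℝ (Fin dα) × EuclideanSpace ℝ (Fin dg) ×
      CCP J m X => ψ q.1 q.2.1 q.2.2 with hF
  set z : T → EuclideanSpace ℝ (Fin dα) × EuclideanSpace ℝ (Fin dg) × CCP J m X :=
    fun t => (a t, g t, P t) with hz
  have hzlim : Tendsto z l (𝓝 (α₀, g₀, P₀)) := ha.prodMk_nhds (hg.prodMk_nhds hP)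
  have hdiff : ∀ᶠ t in l, DifferentiableAt ℝ F (z t) :=
    hzlim.eventually ((hψ.eventually (by simp)).mono fun q hq => hq.differentiableAt (by simp))
  -- the Jacobian in `α` at the estimator, which converges to `A`
  set G : T → Matrix (CCPIdx J m X) (Fin dα) ℝ :=
    fun t => jacobian (fun b => ψ b (g t) (P t)) (a t) with hG
  have hpart : ∀ q, DifferentiableAt ℝ F q → HasFDerivAt (fun b => ψ b q.2.1 q.2.2)
      ((fderiv ℝ F q).comp (ContinuousLinearMap.inl ℝ _ _)) q.1 := fun q hq =>
    HasFDerivAt.comp (g := F) (f := fun b => (b, q.2)) q.1 hq.hasFDerivAt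
      (hasFDerivAt_prodMk_left q.1 q.2)
  have hFcont : ContinuousAt (fderiv ℝ F) (α₀, g₀, P₀) :=
    (hψ.fderiv_right (m := 1) (by norm_num)).continuousAt
  have hGlim : Tendsto G l (𝓝 A) := by
    refine tendsto_pi_nhds.2 fun i => tendsto_pi_nhds.2 fun j => ?_
    have h1 : Tendsto (fun t => fderiv ℝ F (z t) (EuclideanSpace.single j 1, 0, 0) i) l
        (𝓝 (fderiv ℝ F (α₀, g₀, P₀) (EuclideanSpace.single j 1, 0, 0) i)) := by
      have h2 : Tendsto (fun t => fderiv ℝ F (z t)) l (𝓝 (fderiv ℝ F (α₀, g₀, P₀))) :=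
        hFcont.tendsto.comp hzlim
      have hc : Continuous fun L : (EuclideanSpace ℝ (Fin dα) × EuclideanSpace ℝ (Fin dg) ×
          CCP J m X) →L[ℝ] CCP J m X => L (EuclideanSpace.single j 1, 0, 0) i := by fun_prop
      exact (hc.tendsto _).comp h2
    have h4 : A i j = fderiv ℝ F (α₀, g₀, P₀) (EuclideanSpace.single j 1, 0, 0) i := by
      have := (hpart _ (hψ.differentiableAt (by simp))).fderiv
      simp only at this
      rw [hA, jacobian, Matrix.of_apply, this]
      rfl
    rw [h4]
    refine h1.congr' (hdiff.mono fun t ht => ?_)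
    have := (hpart _ ht).fderiv
    simp only [hz] at this
    simp only [hG, jacobian, Matrix.of_apply, this]
    rfl
  set r : T → CCP J m X := fun t => p t - ψ (a t) (g t) (P t) with hr
  have hfoc : ∀ᶠ t in l, mulVecCLM ((G t)ᵀ * (Wh t + (Wh t)ᵀ)) (r t) = 0 := by
    filter_upwards [hdiff, hmax, ha.eventually (isOpen_interior.mem_nhds hΘ)] with t h1 h2 h3
    exact firstOrder_mdCriterion (hpart _ h1).differentiableAt
      (h2.isLocalMax (mem_interior_iff_mem_nhds.1 h3))
  -- `σ` is the scale of all the increments, that of `a` included; only at the end is the increment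
  -- of `a` shown to be of order `τ`
  set σ : T → ℝ := fun t => ‖τ t‖ + ‖a t - α₀‖ with hσ
  have hτσ : τ =O[l] σ := IsBigO.of_bound 1 (Eventually.of_forall fun t => by
    rw [one_mul, Real.norm_of_nonneg (by positivity : 0 ≤ σ t)]
    simp [hσ])
  have haσ : (fun t => a t - α₀) =O[l] σ := IsBigO.of_bound 1 (Eventually.of_forall fun t => by
    rw [one_mul, Real.norm_of_nonneg (by positivity : 0 ≤ σ t)]
    simp [hσ])
  have hexp := expansion_of_map (hψ.differentiableAt (by simp)) ha hg hP haσ (hgτ.trans hτσ)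
    (hPτ.trans hτσ)
  rw [hfix, ← hA, ← hD, ← hB] at hexp
  set ρ := fun t => ψ (a t) (g t) (P t) - P₀ -
    (mulVecCLM A (a t - α₀) + mulVecCLM D (g t - g₀) + mulVecCLM B (P t - P₀)) with hρ
  have hrσ : r =O[l] σ := by
    have h1 := ((hpτ.trans hτσ).sub hexp.isBigO).sub
      ((((mulVecCLM A).isBigO_comp _ l).trans haσ).add
      (((mulVecCLM D).isBigO_comp _ l).trans (hgτ.trans hτσ)) |>.add
      (((mulVecCLM B).isBigO_comp _ l).trans (hPτ.trans hτσ)))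
    refine h1.congr_left fun t => ?_
    simp only [hρ, hr]
    abel
  have hMlim : Tendsto (fun t => mulVecCLM ((G t)ᵀ * (Wh t + (Wh t)ᵀ)) -
      mulVecCLM (Aᵀ * (W + Wᵀ))) l (𝓝 0) := by
    rw [← sub_self (mulVecCLM (Aᵀ * (W + Wᵀ)))]
    refine Tendsto.sub_const ((continuous_mulVecCLM.tendsto _).comp ?_) _
    have hc : Continuous fun w : Matrix (CCPIdx J m X) (Fin dα) ℝ ×
        Matrix (CCPIdx J m X) (CCPIdx J m X) ℝ => w.1ᵀ * (w.2 + w.2ᵀ) := by fun_prop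
    have hGW : Tendsto (fun t => (G t, Wh t)) l (𝓝 (A, W)) := hGlim.prodMk_nhds hWh
    have hcomp := (hc.tendsto (A, W)).comp hGW
    exact hcomp
  -- the residual is annihilated by matrices converging to `2 A' W`
  have hMr : (fun t => mulVecCLM (Aᵀ * (W + Wᵀ)) (r t)) =o[l] σ := by
    refine IsLittleO.trans_isBigO ?_ hrσ
    refine IsLittleO.of_bound fun c hc => ?_
    filter_upwards [hfoc, Metric.tendsto_nhds.1 hMlim c hc] with t h1 h2
    rw [dist_zero_right] at h2
    have h3 : mulVecCLM (Aᵀ * (W + Wᵀ)) (r t) = -((mulVecCLM ((G t)ᵀ * (Wh t + (Wh t)ᵀ)) -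
        mulVecCLM (Aᵀ * (W + Wᵀ))) (r t)) := by
      rw [sub_apply, h1, zero_sub, neg_neg]
    rw [h3, norm_neg]
    exact (ContinuousLinearMap.le_opNorm _ _).trans (by gcongr)
  have hSr : (fun t => mulVecCLM ((Aᵀ * W * A)⁻¹ * Aᵀ * W) (r t)) =o[l] σ := by
    have h1 := ((((mulVecCLM (Aᵀ * W * A)⁻¹)).isBigO_comp _ l).trans_isLittleO hMr).const_smul_left
      (2⁻¹ : ℝ)
    refine h1.congr_left fun t => ?_
    rw [Pi.smul_apply, ← mulVecCLM_mul, hW, ← two_smul ℝ W, Matrix.mul_smul, Matrix.mul_smul]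
    apply WithLp.ofLp_injective 2
    simp [Matrix.smul_mulVec, Matrix.mul_assoc]
  have herr : (fun t => a t - α₀ - mulVecCLM ((Aᵀ * W * A)⁻¹ * Aᵀ * W)
      ((p t - P₀) - mulVecCLM D (g t - g₀) - mulVecCLM B (P t - P₀))) =o[l] σ := by
    have h1 := (hSr.add (((mulVecCLM ((Aᵀ * W * A)⁻¹ * Aᵀ * W)).isBigO_comp _ l).trans_isLittleO
      hexp)).neg_left
    refine h1.congr_left fun t => ?_
    have h2 : mulVecCLM ((Aᵀ * W * A)⁻¹ * Aᵀ * W) (mulVecCLM A (a t - α₀)) = a t - α₀ := by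
      rw [← mulVecCLM_mul, Matrix.mul_assoc, Matrix.mul_assoc, ← Matrix.mul_assoc Aᵀ,
        Matrix.nonsing_inv_mul _ hdet, mulVecCLM_one]
    have h3 : r t + ρ t = (p t - P₀) - mulVecCLM D (g t - g₀) - mulVecCLM B (P t - P₀) -
        mulVecCLM A (a t - α₀) := by
      simp only [hr, hρ]
      abel
    rw [← map_add, h3, map_sub _ _ (mulVecCLM A _), h2, neg_sub]
  have hbig : (fun t => mulVecCLM ((Aᵀ * W * A)⁻¹ * Aᵀ * W)
      ((p t - P₀) - mulVecCLM D (g t - g₀) - mulVecCLM B (P t - P₀))) =O[l] τ :=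
    ((mulVecCLM ((Aᵀ * W * A)⁻¹ * Aᵀ * W)).isBigO_comp _ l).trans
      ((hpτ.sub (((mulVecCLM D).isBigO_comp _ l).trans hgτ)).sub
        (((mulVecCLM B).isBigO_comp _ l).trans hPτ))
  have haτ : (fun t => a t - α₀) =O[l] τ := isBigO_of_sub_isLittleO_add hbig herr
  exact ⟨haτ, herr.trans_isBigO ((isBigO_refl τ l).norm_left.add haτ.norm_left)⟩

end Linearization

/-! ### The iterated estimators along a filter -/

section Iteration

variable {ι κ γ : Type*} [Fintype ι] [DecidableEq ι] [Fintype κ] [DecidableEq κ]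
  [Fintype γ] [DecidableEq γ]

/-- Error propagation for the updated beliefs. Here `π` and `π'` are the deviations of the current
and the updated beliefs from their limit, and `p`, `b`, `d` those of the preliminary estimators. The
error of approximating `π'` with the coefficients `Φ_{k+2}` is linear in the linearization error of
the map, the error in the expansion of the estimator, and the error of approximating `π` with
`Φ_{k+1}`; this identity is where the recursion defining `Φ` comes from. -/
lemma belief_error_step (A : Matrix ι κ ℝ) (B : Matrix ι ι ℝ) (W : ℕ → Matrix ι ι ℝ) (k : ℕ)
    (a : EuclideanSpace ℝ κ) (p b d π π' : EuclideanSpace ℝ ι) :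
    π' - (mulVecCLM (phiP A B W (k + 2)) p + mulVecCLM (phi0 A B W (k + 2)) b +
        mulVecCLM (phiG A B W (k + 2)) d) =
      (π' - (mulVecCLM A a + d + mulVecCLM B π)) +
      mulVecCLM A (a - mulVecCLM ((Aᵀ * W (k + 1) * A)⁻¹ * Aᵀ * W (k + 1))
        (p - d - mulVecCLM B π)) +
      mulVecCLM ((1 - wProj A (W (k + 1))) * B)
        (π - (mulVecCLM (phiP A B W (k + 1)) p + mulVecCLM (phi0 A B W (k + 1)) b +
          mulVecCLM (phiG A B W (k + 1)) d)) := by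
  have hH : wProj A (W (k + 1)) = A * ((Aᵀ * W (k + 1) * A)⁻¹ * Aᵀ * W (k + 1)) := by
    simp only [wProj, Matrix.mul_assoc]
  simp only [phiP, phi0, phiG, hH, mulVecCLM_add, mulVecCLM_sub, mulVecCLM_mul _ _ _,
    mulVecCLM_one, map_add, map_sub]
  abel

lemma mulVecCLM_fromCols_stack {J m X dg : ℕ} {ι : Type*} [Fintype ι]
    (M N : Matrix ι (CCPIdx J m X) ℝ) (L : Matrix ι (Fin dg) ℝ) (p b : CCP J m X)
    (d : EuclideanSpace ℝ (Fin dg)) :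
    mulVecCLM (Matrix.fromCols M (Matrix.fromCols N L)) (stack p b d) =
      mulVecCLM M p + (mulVecCLM N b + mulVecCLM L d) := by
  apply WithLp.ofLp_injective 2
  simp [stack, Matrix.fromCols_mulVec]

/-- The block row of the asymptotic variance, applied to the preliminary errors `p`, `b`, `d`, is
`p - D d - B π` with `π` the linear approximation `Φ_k` of the beliefs. -/
lemma mulVecCLM_sandwichRow_stack {J m X dg : ℕ} (A : Matrix (CCPIdx J m X) κ ℝ)
    (B : Matrix (CCPIdx J m X) (CCPIdx J m X) ℝ) (D : Matrix (CCPIdx J m X) (Fin dg) ℝ)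
    (W : ℕ → Matrix (CCPIdx J m X) (CCPIdx J m X) ℝ) (k : ℕ) (p b : CCP J m X)
    (d : EuclideanSpace ℝ (Fin dg)) :
    mulVecCLM (sandwichRow A B D W k) (stack p b d) =
      p - mulVecCLM D d - mulVecCLM B (mulVecCLM (phiP A B W k) p + mulVecCLM (phi0 A B W k) b +
        mulVecCLM (phiG A B W k) (mulVecCLM D d)) := by
  rw [sandwichRow, mulVecCLM_fromCols_stack]
  simp only [mulVecCLM_add, mulVecCLM_sub, mulVecCLM_neg, mulVecCLM_mul _ _ _, mulVecCLM_one,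
    map_add]
  abel

variable {J m X dα dg : ℕ} {T : Type*} {l : Filter T}
  {ψ : EuclideanSpace ℝ (Fin dα) → EuclideanSpace ℝ (Fin dg) → CCP J m X → CCP J m X}
  {α₀ : EuclideanSpace ℝ (Fin dα)} {g₀ : EuclideanSpace ℝ (Fin dg)} {P₀ : CCP J m X}

/-- Joint consistency of the iterated estimators and of the beliefs they generate. -/
lemma tendsto_iterated
    (hψ : ContinuousAt (fun q : EuclideanSpace ℝ (Fin dα) × EuclideanSpace ℝ (Fin dg) ×
      CCP J m X => ψ q.1 q.2.1 q.2.2) (α₀, g₀, P₀))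
    {Θ : Set (EuclideanSpace ℝ (Fin dα))} (hΘ : IsCompact Θ) (hα₀ : α₀ ∈ Θ)
    {Θg : Set (EuclideanSpace ℝ (Fin dg))}
    (hid : ∀ α ∈ Θ, ψ α g₀ P₀ = P₀ ↔ α = α₀) {c : ℝ} (hc : ∀ α ∈ Θ, ‖ψ α g₀ P₀‖ ≤ c)
    (hunif : ∀ δ > 0, ∀ᶠ q in 𝓝 (g₀, P₀), q.1 ∈ Θg →
      ∀ α ∈ Θ, ‖ψ α q.1 q.2 - ψ α g₀ P₀‖ ≤ δ)
    {K : ℕ} {W : ℕ → Matrix (CCPIdx J m X) (CCPIdx J m X) ℝ}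
    (hW : ∀ k, 1 ≤ k → k ≤ K → (W k).PosDef)
    (husc : ∀ k, 1 ≤ k → k ≤ K →
      UpperSemicontinuousOn (fun α => mdCriterion (W k) P₀ (ψ α g₀ P₀)) Θ)
    {p : T → CCP J m X} {g : T → EuclideanSpace ℝ (Fin dg)} {P : ℕ → T → CCP J m X}
    {Wh : ℕ → T → Matrix (CCPIdx J m X) (CCPIdx J m X) ℝ} {a : ℕ → T → EuclideanSpace ℝ (Fin dα)}
    (hp : Tendsto p l (𝓝 P₀)) (hg : Tendsto g l (𝓝 g₀)) (hgΘ : ∀ᶠ t in l, g t ∈ Θg)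
    (hP : Tendsto (P 0) l (𝓝 P₀)) (hWh : ∀ k, 1 ≤ k → k ≤ K → Tendsto (Wh k) l (𝓝 (W k)))
    (hstep : ∀ k t, P (k + 1) t = ψ (a (k + 1) t) (g t) (P k t))
    (hmax : ∀ k, k + 1 ≤ K → ∀ᶠ t in l, a (k + 1) t ∈ Θ ∧
      IsMaxOn (fun b => mdCriterion (Wh (k + 1) t) (p t) (ψ b (g t) (P k t))) Θ (a (k + 1) t))
    (k : ℕ) (hk : k ≤ K) :
    Tendsto (P k) l (𝓝 P₀) ∧ (1 ≤ k → Tendsto (a k) l (𝓝 α₀)) := by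
  induction k with
  | zero => exact ⟨hP, fun h => absurd h (by norm_num)⟩
  | succ k ih =>
    have hPk := (ih (by omega)).1
    have ha : Tendsto (a (k + 1)) l (𝓝 α₀) := by
      refine tendsto_of_isMaxOn_mdCriterion (q := fun t α => ψ α (g t) (P k t)) hΘ hα₀
        (hW (k + 1) (by omega) hk) hid (husc (k + 1) (by omega) hk) hc
        (hWh (k + 1) (by omega) hk) hp (fun δ hδ => ?_) (hmax k hk)
      filter_upwards [(hg.prodMk_nhds hPk).eventually (hunif δ hδ), hgΘ] with t h1 h2
      exact h1 h2
    refine ⟨?_, fun _ => ha⟩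
    have h1 : Tendsto (fun t => (a (k + 1) t, g t, P k t)) l (𝓝 (α₀, g₀, P₀)) :=
      ha.prodMk_nhds (hg.prodMk_nhds hPk)
    have h2 := hψ.tendsto.comp h1
    rw [(hid α₀ hα₀).2 rfl] at h2
    exact h2.congr fun t => (hstep k t).symm

/-- Linear expansion of the iterated estimator. The beliefs used at step `k + 1` are, up to
`o(τ)`, the linear combination of the preliminary estimators with coefficients `Φ_{k+1}`; inserting
this into the expansion of a single minimum distance step gives the expansion of the estimator. -/
lemma expansion_of_iterated
    (hψ : ContDiffAt ℝ 2 (fun q : EuclideanSpace ℝ (Fin dα) × EuclideanSpace ℝ (Fin dg) ×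
      CCP J m X => ψ q.1 q.2.1 q.2.2) (α₀, g₀, P₀)) (hfix : ψ α₀ g₀ P₀ = P₀)
    {Θ : Set (EuclideanSpace ℝ (Fin dα))} (hΘ : α₀ ∈ interior Θ)
    {A : Matrix (CCPIdx J m X) (Fin dα) ℝ} {D : Matrix (CCPIdx J m X) (Fin dg) ℝ}
    {B : Matrix (CCPIdx J m X) (CCPIdx J m X) ℝ}
    (hA : A = jacobian (fun α => ψ α g₀ P₀) α₀) (hD : D = jacobian (fun g => ψ α₀ g P₀) g₀)
    (hB : B = jacobian (fun P => ψ α₀ g₀ P) P₀) (hAinj : Function.Injective A.mulVec)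
    {K : ℕ} {W : ℕ → Matrix (CCPIdx J m X) (CCPIdx J m X) ℝ}
    (hW : ∀ k, 1 ≤ k → k ≤ K → (W k).PosDef)
    {p : T → CCP J m X} {g : T → EuclideanSpace ℝ (Fin dg)} {P : ℕ → T → CCP J m X}
    {Wh : ℕ → T → Matrix (CCPIdx J m X) (CCPIdx J m X) ℝ} {a : ℕ → T → EuclideanSpace ℝ (Fin dα)}
    (ha : ∀ k, 1 ≤ k → k ≤ K → Tendsto (a k) l (𝓝 α₀))
    (hP : ∀ k ≤ K, Tendsto (P k) l (𝓝 P₀)) (hg : Tendsto g l (𝓝 g₀))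
    (hWh : ∀ k, 1 ≤ k → k ≤ K → Tendsto (Wh k) l (𝓝 (W k)))
    (hstep : ∀ k t, P (k + 1) t = ψ (a (k + 1) t) (g t) (P k t))
    (hmax : ∀ k, k + 1 ≤ K → ∀ᶠ t in l,
      IsMaxOn (fun b => mdCriterion (Wh (k + 1) t) (p t) (ψ b (g t) (P k t))) Θ (a (k + 1) t))
    {τ : T → ℝ} (hpτ : (fun t => p t - P₀) =O[l] τ) (hPτ : (fun t => P 0 t - P₀) =O[l] τ)
    (hgτ : (fun t => g t - g₀) =O[l] τ) (hK : 1 ≤ K) :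
    (fun t => a K t - α₀ - mulVecCLM ((Aᵀ * W K * A)⁻¹ * Aᵀ * W K * sandwichRow A B D W K)
      (stack (p t - P₀) (P 0 t - P₀) (g t - g₀))) =o[l] τ := by
  have hstepa : ∀ k, k + 1 ≤ K → (fun t => P k t - P₀) =O[l] τ →
      (fun t => a (k + 1) t - α₀) =O[l] τ ∧
      (fun t => a (k + 1) t - α₀ - mulVecCLM ((Aᵀ * W (k + 1) * A)⁻¹ * Aᵀ * W (k + 1))
        ((p t - P₀) - mulVecCLM D (g t - g₀) - mulVecCLM B (P k t - P₀))) =o[l] τ :=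
    fun k hk hPk => expansion_of_isMaxOn hψ hfix hΘ hA hD hB
      (by simpa using (hW (k + 1) (by omega) hk).isHermitian.eq)
      (isUnit_det_weightedGram hAinj (hW (k + 1) (by omega) hk)) (ha (k + 1) (by omega) hk) hg
      (hP k (by omega)) (hWh (k + 1) (by omega) hk) hgτ hPk hpτ (hmax k hk)
  have hbelief : ∀ k, k + 1 ≤ K → (fun t => P k t - P₀) =O[l] τ ∧
      (fun t => P k t - P₀ - (mulVecCLM (phiP A B W (k + 1)) (p t - P₀) +
        mulVecCLM (phi0 A B W (k + 1)) (P 0 t - P₀) +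
        mulVecCLM (phiG A B W (k + 1)) (mulVecCLM D (g t - g₀)))) =o[l] τ := by
    intro k
    induction k with
    | zero =>
      intro _
      refine ⟨hPτ, (isLittleO_zero τ l).congr_left fun t => ?_⟩
      simp [phiP, phi0, phiG]
    | succ k ih =>
      intro hk
      obtain ⟨hO, ho⟩ := ih (by omega)
      obtain ⟨haO, hao⟩ := hstepa k (by omega) hO
      have hmap := expansion_of_map (hψ.differentiableAt (by simp))
        (ha (k + 1) (by omega) (by omega)) hg (hP k (by omega)) haO hgτ hO
      rw [hfix, ← hA, ← hD, ← hB] at hmap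
      have hmap' := hmap.congr_left fun t => by rw [← hstep k t]
      have herr := (hmap'.add (((mulVecCLM A).isBigO_comp _ l).trans_isLittleO hao)).add
        (((mulVecCLM ((1 - wProj A (W (k + 1))) * B)).isBigO_comp _ l).trans_isLittleO ho)
      have herr' := herr.congr_left fun t => (belief_error_step A B W k _ _ _ _ _ _).symm
      refine ⟨?_, herr'⟩
      have hlin := (((((mulVecCLM (phiP A B W (k + 2))).isBigO_comp _ l).trans hpτ).add
        (((mulVecCLM (phi0 A B W (k + 2))).isBigO_comp _ l).trans hPτ)).add
        (((mulVecCLM (phiG A B W (k + 2))).isBigO_comp _ l).trans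
          (((mulVecCLM D).isBigO_comp _ l).trans hgτ)))
      exact (herr'.isBigO.add hlin).congr_left fun t => sub_add_cancel _ _
  obtain ⟨k, rfl⟩ : ∃ k, K = k + 1 := ⟨K - 1, by omega⟩
  obtain ⟨hO, ho⟩ := hbelief k le_rfl
  have h1 := (hstepa k le_rfl hO).2.sub
    ((((mulVecCLM ((Aᵀ * W (k + 1) * A)⁻¹ * Aᵀ * W (k + 1))).isBigO_comp _ l).trans
      ((mulVecCLM B).isBigO_comp _ l)).trans_isLittleO ho)
  refine h1.congr_left fun t => ?_
  rw [mulVecCLM_mul _ (sandwichRow A B D W (k + 1)), mulVecCLM_sandwichRow_stack, sub_sub,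
    ← map_add, map_sub (mulVecCLM B) (P k t - P₀)]
  congr 2
  abel

end Iteration

/-! ### Convergence in probability as convergence along a filter -/

section InProbability

variable {Ω : Type*} [MeasurableSpace Ω] {μ : Measure Ω}

/-- The filter on `ℕ × Ω` of the events that have probability approaching one, so that `o_p`
statements become statements about limits and Landau symbols along this filter. -/
def inProb (μ : Measure Ω) : Filter (ℕ × Ω) where
  sets := {S | WPA1 μ fun n ω => (n, ω) ∈ S}
  univ_sets := by simp [WPA1]
  sets_of_superset {S T} hS hST :=
    tendsto_of_tendsto_of_tendsto_of_le_of_le tendsto_const_nhds hS (fun _ => zero_le)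
      fun n => measure_mono fun ω hω h => hω (hST h)
  inter_sets {S T} hS hT := by
    refine tendsto_of_tendsto_of_tendsto_of_le_of_le tendsto_const_nhds
      (by simpa using Tendsto.add hS hT) (fun _ => zero_le) fun n => ?_
    refine (measure_mono fun ω hω => ?_).trans (measure_union_le _ _)
    exact not_and_or.1 hω

lemma eventually_inProb {p : ℕ × Ω → Prop} :
    (∀ᶠ t in inProb μ, p t) ↔ WPA1 μ fun n ω => p (n, ω) := Iff.rfl

lemma tendsto_inProb_iff {E : Type*} [SeminormedAddCommGroup E] {f : ℕ → Ω → E} {c : E} :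
    Tendsto (fun t : ℕ × Ω => f t.1 t.2) (inProb μ) (𝓝 c) ↔
      TendstoInMeasure μ f atTop fun _ => c := by
  simp only [Metric.tendsto_nhds, tendstoInMeasure_iff_norm, eventually_inProb, WPA1, not_lt,
    dist_eq_norm, gt_iff_lt]

lemma eventually_inProb_of_eventually {p : ℕ → Prop} (h : ∀ᶠ n in atTop, p n) :
    ∀ᶠ t in inProb μ, p t.1 := by
  refine eventually_inProb.2 (tendsto_const_nhds.congr' ?_)
  filter_upwards [h] with n hn
  simp [hn]

lemma tendsto_fst_inProb : Tendsto Prod.fst (inProb μ) atTop :=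
  fun _ hs => eventually_inProb_of_eventually hs

/-- A nonrandom event that holds with probability approaching one holds eventually. -/
lemma eventually_of_wpa1 [IsProbabilityMeasure μ] {p : ℕ → Prop} (h : WPA1 μ fun n _ => p n) :
    ∀ᶠ n in atTop, p n := by
  filter_upwards [h.eventually (gt_mem_nhds zero_lt_one)] with n hn
  by_contra hp
  simp [hp] at hn

/-- Sequences that converge in distribution are tight. -/
lemma exists_eventually_measure_norm_ge_le [IsProbabilityMeasure μ] {E : Type*}
    [NormedAddCommGroup E] [MeasurableSpace E] [BorelSpace E] {Y : ℕ → Ω → E} {ν : Measure E}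
    [IsProbabilityMeasure ν] (hY : TendstoInDistribution Y atTop id (fun _ => μ) ν)
    {η : ENNReal} (hη : 0 < η) : ∃ M : ℝ, ∀ᶠ n in atTop, μ {ω | M ≤ ‖Y n ω‖} ≤ η := by
  have h0 : Tendsto (fun M : ℕ => ν {x | (M : ℝ) ≤ ‖x‖}) atTop (𝓝 0) := by
    have hinter : ⋂ M : ℕ, {x : E | (M : ℝ) ≤ ‖x‖} = ∅ := by
      refine Set.eq_empty_of_forall_notMem fun x hx => ?_
      obtain ⟨M, hM⟩ := exists_nat_gt ‖x‖
      exact absurd (Set.mem_iInter.1 hx M) (not_le.2 hM)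
    rw [← measure_empty (μ := ν), ← hinter]
    refine tendsto_measure_iInter_atTop
      (fun M => (isClosed_le continuous_const continuous_norm).measurableSet.nullMeasurableSet)
      (fun a b hab x hx => ?_) ⟨0, measure_ne_top _ _⟩
    exact (Nat.cast_le.2 hab).trans (show (b : ℝ) ≤ ‖x‖ from hx)
  obtain ⟨M, hM⟩ := (h0.eventually (gt_mem_nhds hη)).exists
  have hclosed : IsClosed {x : E | (M : ℝ) ≤ ‖x‖} := isClosed_le continuous_const continuous_norm
  have hlim := ProbabilityMeasure.limsup_measure_closed_le_of_tendsto hY.tendsto hclosed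
  simp only [ProbabilityMeasure.coe_mk, Measure.map_id] at hlim
  refine ⟨M, ?_⟩
  filter_upwards [eventually_lt_of_limsup_lt (hlim.trans_lt hM)] with n hn
  rw [Measure.map_apply_of_aemeasurable (hY.forall_aemeasurable n) hclosed.measurableSet] at hn
  exact hn.le

/-- A random sequence that is `o_p` of a sequence converging in distribution is `o_p(1)`. -/
lemma tendsto_zero_of_isLittleO_inProb [IsProbabilityMeasure μ] {E F : Type*}
    [NormedAddCommGroup E] [MeasurableSpace E] [BorelSpace E] [SeminormedAddCommGroup F]
    {Y : ℕ → Ω → E} {ν : Measure E}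
    [IsProbabilityMeasure ν] (hY : TendstoInDistribution Y atTop id (fun _ => μ) ν)
    {f : ℕ × Ω → F} (hf : f =o[inProb μ] fun t => Y t.1 t.2) : Tendsto f (inProb μ) (𝓝 0) := by
  rw [Metric.tendsto_nhds]
  intro ε hε
  rw [eventually_inProb, WPA1, ENNReal.tendsto_nhds_zero]
  intro η hη
  obtain ⟨M, hM⟩ := exists_eventually_measure_norm_ge_le hY (ENNReal.half_pos hη.ne')
  have hc : 0 < ε / (|M| + 1) := by positivity
  have h1 : WPA1 μ _ := eventually_inProb.1 (hf.bound hc)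
  filter_upwards [hM, ENNReal.tendsto_nhds_zero.1 h1 _ (ENNReal.half_pos hη.ne')] with n h2 h3
  rw [← ENNReal.add_halves η]
  refine ((measure_mono fun ω hω => ?_).trans (measure_union_le _ _)).trans (add_le_add h3 h2)
  by_contra hcon
  rw [Set.mem_union, not_or] at hcon
  have h5 : ‖f (n, ω)‖ ≤ ε / (|M| + 1) * ‖Y n ω‖ := not_not.1 hcon.1
  have h6 : ‖Y n ω‖ < M := not_le.1 hcon.2
  refine hω ?_
  rw [dist_zero_right]
  have h4 : ‖Y n ω‖ < |M| + 1 := by linarith [le_abs_self M]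
  calc ‖f (n, ω)‖ ≤ ε / (|M| + 1) * ‖Y n ω‖ := h5
    _ < ε / (|M| + 1) * (|M| + 1) := by gcongr
    _ = ε := div_mul_cancel₀ _ (by positivity)

end InProbability

/-- Convergence in distribution depends on the limit variable only through its law. -/
lemma tendstoInDistribution_id_of_map_eq {Ω Ω' E : Type*} [MeasurableSpace Ω] {μ : Measure Ω}
    [IsProbabilityMeasure μ] [MeasurableSpace Ω'] {μ' : Measure Ω'} [IsProbabilityMeasure μ']
    [TopologicalSpace E] [MeasurableSpace E] [OpensMeasurableSpace E] {Y : ℕ → Ω → E}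
    {Z : Ω' → E} {ν : Measure E} [IsProbabilityMeasure ν]
    (h : TendstoInDistribution Y atTop Z (fun _ => μ) μ') (hZ : μ'.map Z = ν) :
    TendstoInDistribution Y atTop id (fun _ => μ) ν where
  forall_aemeasurable := h.forall_aemeasurable
  aemeasurable_limit := aemeasurable_id
  tendsto := by
    have h1 := h.tendsto
    simp only [hZ] at h1
    simpa only [Measure.map_id] using h1

/-! ### Properties of the choice probability map -/

section Psi

variable {J m X dα dg : ℕ}

lemma norm_psi_le {G : Game J m X} (hG : G.IsAdmissible) (P : CCP J m X) :
    ‖G.psi P‖ ≤ √(Fintype.card (CCPIdx J m X)) := by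
  rw [EuclideanSpace.norm_eq]
  refine Real.sqrt_le_sqrt ?_
  calc ∑ i, ‖G.psi P i‖ ^ 2 ≤ ∑ _i : CCPIdx J m X, (1 : ℝ) := by
        refine Finset.sum_le_sum fun i _ => ?_
        have := hG.shock_prob i.2.2
        have h1 : ‖G.psi P i‖ ≤ 1 := by
          refine (norm_integral_le_of_norm_le_const (C := 1)
            (Eventually.of_forall fun ε => ?_)).trans (by simp)
          rw [norm_prod]
          refine Finset.prod_le_one (fun _ _ => norm_nonneg _) fun k _ => ?_
          split_ifs <;> simp
        exact pow_le_one₀ (norm_nonneg _) h1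
    _ = _ := by simp

/-- Stochastic uniform convergence of `Ψ(·, g̃, P̃)` along every consistent sequence is uniform
convergence as `(g, P) → (g*, P*)`: otherwise some nonrandom sequence, which is a consistent
sequence of random vectors, violates it. -/
lemma Regular.eventually_uniform {Ω : Type*} [MeasurableSpace Ω] {μ : Measure Ω}
    [IsProbabilityMeasure μ]
    {𝒢 : EuclideanSpace ℝ (Fin dα) → EuclideanSpace ℝ (Fin dg) → Game J m X}
    {Θα : Set (EuclideanSpace ℝ (Fin dα))} {Θg : Set (EuclideanSpace ℝ (Fin dg))}
    {αs : EuclideanSpace ℝ (Fin dα)} {gs : EuclideanSpace ℝ (Fin dg)} {Ps : CCP J m X}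
    (h : Regular μ 𝒢 Θα Θg αs gs Ps) {δ : ℝ} (hδ : 0 < δ) :
    ∀ᶠ q in 𝓝 (gs, Ps), q.1 ∈ Θg →
      ∀ α ∈ Θα, ‖(𝒢 α q.1).psi q.2 - (𝒢 α gs).psi Ps‖ ≤ δ := by
  by_contra hcon
  obtain ⟨q, hq, hbad⟩ := exists_seq_forall_of_frequently (not_eventually.1 hcon)
  have hcons : ConsistentPair μ Θg gs Ps (fun n _ => (q n).1) (fun n _ => (q n).2) :=
    { measurable_g := fun _ => measurable_const
      measurable_P := fun _ => measurable_const
      mem := fun n _ => (Classical.not_imp.1 (hbad n)).1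
      tendsto_g := tendsto_inProb_iff.1
        (((continuous_fst.tendsto _).comp hq).comp tendsto_fst_inProb)
      tendsto_P := tendsto_inProb_iff.1
        (((continuous_snd.tendsto _).comp hq).comp tendsto_fst_inProb) }
  obtain ⟨n, hn⟩ := (eventually_of_wpa1 (h.uniform _ _ hcons δ hδ)).exists
  exact (Classical.not_imp.1 (hbad n)).2 hn

lemma norm_sq_stack (p b : CCP J m X) (d : EuclideanSpace ℝ (Fin dg)) :
    ‖stack p b d‖ ^ 2 = ‖p‖ ^ 2 + (‖b‖ ^ 2 + ‖d‖ ^ 2) := by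
  simp only [EuclideanSpace.norm_sq_eq, stack, Fintype.sum_sum_type]
  rfl

lemma norm_le_norm_stack (p b : CCP J m X) (d : EuclideanSpace ℝ (Fin dg)) :
    ‖p‖ ≤ ‖stack p b d‖ ∧ ‖b‖ ≤ ‖stack p b d‖ ∧ ‖d‖ ≤ ‖stack p b d‖ := by
  have h := norm_sq_stack p b d
  refine ⟨?_, ?_, ?_⟩ <;>
    exact le_of_sq_le_sq (by nlinarith [sq_nonneg ‖p‖, sq_nonneg ‖b‖, sq_nonneg ‖d‖])
      (norm_nonneg _)

end Psi

/-! ### The asymptotic variance -/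

section Variance

variable {ι κ γ : Type*} [Fintype ι] [DecidableEq ι] [Fintype κ] [DecidableEq κ] [Fintype γ]

/-- The asymptotic variance is `L C L'`, where `L` is the coefficient of the first-stage errors in
the linear expansion of the estimator. -/
lemma sigmaKMD_eq (A : Matrix ι κ ℝ) (B : Matrix ι ι ℝ) (D : Matrix ι γ ℝ)
    (C : Matrix (ι ⊕ (ι ⊕ γ)) (ι ⊕ (ι ⊕ γ)) ℝ) (W : ℕ → Matrix ι ι ℝ) (K : ℕ) :
    sigmaKMD A B D C W K =
      ((Aᵀ * W K * A)⁻¹ * Aᵀ * W K * sandwichRow A B D W K) * C *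
        ((Aᵀ * W K * A)⁻¹ * Aᵀ * W K * sandwichRow A B D W K)ᵀ := by
  simp only [sigmaKMD, Matrix.transpose_mul, Matrix.transpose_nonsing_inv,
    Matrix.transpose_transpose, Matrix.mul_assoc]

end Variance

end DynGame

/-! ### Asymptotic normality of the `K`-MD estimator -/

theorem theorem2
    {J m X dα dg : ℕ} (hdim : dα ≤ Fintype.card (CCPIdx J m X))
    {Ω : Type*} [MeasurableSpace Ω] (μ : Measure Ω) [IsProbabilityMeasure μ]
    -- the parametric game and the true parameter
    (𝒢 : EuclideanSpace ℝ (Fin dα) → EuclideanSpace ℝ (Fin dg) → Game J m X)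
    (Θα : Set (EuclideanSpace ℝ (Fin dα))) (Θg : Set (EuclideanSpace ℝ (Fin dg)))
    (h𝒢 : ∀ α ∈ Θα, ∀ g ∈ Θg, (𝒢 α g).IsAdmissible)
    (αs : EuclideanSpace ℝ (Fin dα)) (gs : EuclideanSpace ℝ (Fin dg)) (hgs : gs ∈ Θg)
    (Ps : CCP J m X)
    -- i.i.d. data from one equilibrium, identification, regularity
    (Z : ℕ → Ω → Obs J m X) (hZ : IsMPESample μ (𝒢 αs gs) Ps Z)
    (hident : Identified 𝒢 Θα αs gs Ps)
    (hreg : Regular μ 𝒢 Θα Θg αs gs Ps)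
    -- preliminary estimators
    (P₀ : ℕ → Ω → CCP J m X) (gh : ℕ → Ω → EuclideanSpace ℝ (Fin dg))
    (hgh : WPA1 μ fun n ω => gh n ω ∈ Θg)
    (C : Matrix (JointIdx J m X dg) (JointIdx J m X dg) ℝ)
    (hbase : BaselineConvergence μ Z P₀ gh Ps gs C)
    -- weights and the iterated minimum distance estimators
    (K : ℕ) (hK : 1 ≤ K)
    (Wh : ℕ → ℕ → Ω → Matrix (CCPIdx J m X) (CCPIdx J m X) ℝ)
    (W : ℕ → Matrix (CCPIdx J m X) (CCPIdx J m X) ℝ)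
    (hW : WeightConvergence μ Wh W K)
    (αh : ℕ → ℕ → Ω → EuclideanSpace ℝ (Fin dα))
    (hαh : IsKMD μ 𝒢 Θα Z P₀ gh Wh K αh)
    -- compact parameter space and upper semicontinuous limit criteria
    (hcompact : IsCompact Θα)
    (husc : ∀ k, 1 ≤ k → k ≤ K →
      UpperSemicontinuousOn (fun α => mdCriterion (W k) Ps ((𝒢 α gs).psi Ps)) Θα) :
    let V : Matrix (Fin dα) (Fin dα) ℝ :=
      sigmaKMD (psiA 𝒢 αs gs Ps) (psiP 𝒢 αs gs Ps) (psiG 𝒢 αs gs Ps) C W K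
    TendstoInMeasure μ (αh K) atTop (fun _ => αs) ∧
    V.PosSemidef ∧
    TendstoInDistribution (fun (n : ℕ) ω => √(n : ℝ) • (αh K n ω - αs)) atTop id
      (fun _ => μ) (multivariateGaussian 0 V) := by
  intro V
  have hfix : (𝒢 αs gs).psi Ps = Ps := (hident αs (interior_subset hreg.interior)).2 rfl
  have hαs : αs ∈ Θα := interior_subset hreg.interior
  set A := psiA 𝒢 αs gs Ps with hA
  set B := psiP 𝒢 αs gs Ps with hB
  set D := psiG 𝒢 αs gs Ps with hD
  obtain ⟨hC, hdist⟩ := hbase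
  set L := (Aᵀ * W K * A)⁻¹ * Aᵀ * W K * sandwichRow A B D W K with hL
  have hV : V = L * C * Lᵀ := sigmaKMD_eq A B D C W K
  have hVpsd : V.PosSemidef := by
    rw [hV]
    simpa using hC.mul_mul_conjTranspose_same L
  -- `S` stacks the estimation errors of the first-stage estimators
  set S : ℕ × Ω → EuclideanSpace ℝ (JointIdx J m X dg) := fun t =>
    stack (freqCCP Z t.1 t.2 - Ps) (P₀ t.1 t.2 - Ps) (gh t.1 t.2 - gs) with hS
  have hSY : S =o[inProb μ] fun t => √(t.1 : ℝ) • S t := by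
    refine Asymptotics.IsLittleO.of_bound fun c hc => ?_
    have h1 : Tendsto (fun n : ℕ => √(n : ℝ)) atTop atTop :=
      Real.tendsto_sqrt_atTop.comp tendsto_natCast_atTop_atTop
    filter_upwards [eventually_inProb_of_eventually (h1.eventually_ge_atTop c⁻¹)] with t ht
    rw [norm_smul, Real.norm_of_nonneg (Real.sqrt_nonneg _), ← mul_assoc]
    refine le_mul_of_one_le_left (norm_nonneg _) ?_
    rwa [← div_le_iff₀' hc, one_div]
  have hS0 : Tendsto S (inProb μ) (𝓝 0) := tendsto_zero_of_isLittleO_inProb hdist hSY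
  have hnorm0 : Tendsto (fun t => ‖S t‖) (inProb μ) (𝓝 0) := by simpa using hS0.norm
  have hbound := fun t : ℕ × Ω =>
    norm_le_norm_stack (freqCCP Z t.1 t.2 - Ps) (P₀ t.1 t.2 - Ps) (gh t.1 t.2 - gs)
  have hp : Tendsto (fun t : ℕ × Ω => freqCCP Z t.1 t.2) (inProb μ) (𝓝 Ps) :=
    tendsto_sub_nhds_zero_iff.1 (squeeze_zero_norm (fun t => (hbound t).1) hnorm0)
  have hP₀ : Tendsto (fun t : ℕ × Ω => P₀ t.1 t.2) (inProb μ) (𝓝 Ps) :=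
    tendsto_sub_nhds_zero_iff.1 (squeeze_zero_norm (fun t => (hbound t).2.1) hnorm0)
  have hg : Tendsto (fun t : ℕ × Ω => gh t.1 t.2) (inProb μ) (𝓝 gs) :=
    tendsto_sub_nhds_zero_iff.1 (squeeze_zero_norm (fun t => (hbound t).2.2) hnorm0)
  have hWh : ∀ k, 1 ≤ k → k ≤ K →
      Tendsto (fun t : ℕ × Ω => Wh k t.1 t.2) (inProb μ) (𝓝 (W k)) := by
    intro k h1 h2
    refine tendsto_pi_nhds.2 fun i => tendsto_pi_nhds.2 fun j => ?_
    have hij := tendsto_inProb_iff.2 ((hW k h1 h2).2.1 i j)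
    exact hij
  have hWpos : ∀ k, 1 ≤ k → k ≤ K → (W k).PosDef := fun k h1 h2 => (hW k h1 h2).2.2
  set P : ℕ → ℕ × Ω → CCP J m X := fun k t =>
    iterCCP 𝒢 (fun l => αh l t.1 t.2) (gh t.1 t.2) (P₀ t.1 t.2) k with hP
  have hmax : ∀ k, k + 1 ≤ K → ∀ᶠ t in inProb μ, αh (k + 1) t.1 t.2 ∈ Θα ∧
      IsMaxOn (fun α => mdCriterion (Wh (k + 1) t.1 t.2) (freqCCP Z t.1 t.2)
        ((𝒢 α (gh t.1 t.2)).psi (P k t))) Θα (αh (k + 1) t.1 t.2) := fun k hk =>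
    eventually_inProb.2 (hαh (k + 1) (by omega) hk).2
  have hcons := tendsto_iterated (ψ := fun α g => (𝒢 α g).psi) (P := P)
    (a := fun k t => αh k t.1 t.2) hreg.smooth.continuousAt hcompact hαs hident
    (fun α hα => norm_psi_le (h𝒢 α hα gs hgs) Ps) (fun δ hδ => hreg.eventually_uniform hδ) hWpos
    husc hp hg (eventually_inProb.2 hgh) hP₀ hWh (fun k t => rfl) hmax
  have hexp := expansion_of_iterated (ψ := fun α g => (𝒢 α g).psi) (P := P)
    (a := fun k t => αh k t.1 t.2) (τ := fun t => ‖S t‖) hreg.smooth hfix hreg.interior hA hD hB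
    (mulVec_injective_of_fullRank hreg.fullRank_α (by simpa using hdim)) hWpos
    (fun k h1 h2 => (hcons k h2).2 h1) (fun k h => (hcons k h).1) hg hWh (fun k t => rfl)
    (fun k hk => (hmax k hk).mono fun t h => h.2)
    (Asymptotics.IsBigO.of_norm_le fun t => (hbound t).1)
    (Asymptotics.IsBigO.of_norm_le fun t => (hbound t).2.1)
    (Asymptotics.IsBigO.of_norm_le fun t => (hbound t).2.2) hK
  refine ⟨tendsto_inProb_iff.1 ((hcons K le_rfl).2 hK), hVpsd, ?_⟩
  have hlin : TendstoInDistribution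
      (fun (n : ℕ) ω => mulVecCLM L (√(n : ℝ) • S (n, ω))) atTop id (fun _ => μ)
      (multivariateGaussian 0 V) := by
    refine tendstoInDistribution_id_of_map_eq (hdist.continuous_comp (mulVecCLM L).continuous) ?_
    rw [Function.comp_id, multivariateGaussian_map_mulVecCLM hC, hV]
  refine tendstoInDistribution_of_tendstoInMeasure_sub _ _ hlin ?_ fun n =>
    (((hαh K hK le_rfl).1 n).sub_const αs).const_smul √(n : ℝ)
  have hrem : (fun t : ℕ × Ω => √(t.1 : ℝ) • (αh K t.1 t.2 - αs - mulVecCLM L (S t))) =o[inProb μ]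
      fun t => √(t.1 : ℝ) • S t :=
    (Asymptotics.isBigO_refl _ _).smul_isLittleO hexp.of_norm_right
  have hrem0 := tendsto_zero_of_isLittleO_inProb hdist hrem
  refine tendsto_inProb_iff.1 (hrem0.congr fun t => ?_)
  simp only [Pi.sub_apply, map_smul, smul_sub]
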